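/- Let $\ell\geq 1$ and $d\geq 0$ be integers, $\underline{n}=\{1,\dots,n\}$, and let $\mathcal{G}_{(\ell,d)}$ be the groupoid whose objects are all maps $f:\underline{d}\to\underline{\ell}$ and whose morphisms $f\to g$ are the bijections $\sigma:\underline{d}\to\underline{d}$ with $g\circ\sigma=f$, with the usual composition of maps. Let $\mathbb{C}\mathcal{G}_{(\ell,d)}$ be the $\mathbb{C}$-linear category with the same objects whose morphisms are formal complex linear combinations of morphisms of $\mathcal{G}_{(\ell,d)}$. A $\mathbb{C}\mathcal{G}_{(\ell,d)}$-module is a $\mathbb{C}$-linear functor from $\mathbb{C}\mathcal{G}_{(\ell,d)}$ to finite dimensional complex vector spaces; morphisms of modules are natural transformations. A Gelfand model is a module isomorphic to a finite direct sum of simple modules in which every isomorphism class of simple (finite dimensional) modules occurs exactly once. For an object $f$ let $\mathcal{I}^f$ be the set of all $w\in\mathcal{G}_{(\ell,d)}(f,f)$ with $w^2=e$ (including $w=e$). Let $\mathrm{Gelfand}$ be the $\mathbb{C}\mathcal{G}_{(\ell,d)}$-module with $\mathrm{Gelfand}(f)=\mathbb{C}[\mathcal{I}^f]$, the vector space with basis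 $\mathcal{I}^f$, where a morphism $\sigma:f\to g$ acts by $$\mathrm{Gelfand}(\sigma)\cdot w=(-1)^{\mathrm{inv}(\sigma,w)}\,\sigma w\sigma^{-1}\in\mathbb{C}[\mathcal{I}^g],\qquad w\in\mathcal{I}^f,$$ $$\mathrm{inv}(\sigma,w)=|\{(i,j)\in\underline{d}\times\underline{d}\mid i<j,\ w(i)=j,\ \sigma(i)>\sigma(j)\}|,$$ extended linearly. Then $\mathrm{Gelfand}$ is a Gelfand model for $\mathbb{C}\mathcal{G}_{(\ell,d)}$. Consequently, let $\mathbf{C}_\ell$ be the group of complex $\ell$-th roots of unity and let $\mathbf{C}_\ell\wr S_d=\mathbf{C}_\ell^{\,d}\rtimes S_d$, where $(\sigma\cdot a)_i=a_{\sigma^{-1}(i)}$. Let this group act on $\bigoplus_f\mathrm{Gelfand}(f)$ so that $(a,\sigma)$ sends $w\in\mathcal{I}^{f}$ to $$\Big(\prod_{i=1}^d a_i^{\,g(i)}\Big)(-1)^{\mathrm{inv}(\sigma,w)}\,\sigma w\sigma^{-1}\in\mathbb{C}[\mathcal{I}^{g}],\qquad g=f\circ\sigma^{-1}.$$ Then $\bigoplus_f\mathrm{Gelfand}(f)$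 is a Gelfand model for the group $\mathbf{C}_\ell\wr S_d$. -/

import Mathlib

open CategoryTheory CategoryTheory.Limits

/-- An object `M` of a category of finite dimensional modules is a Gelfand model if it is a finite
direct sum of simple objects in which every isomorphism class of simple objects occurs exactly
once. -/
def IsGelfandModel {C : Type*} [Category* C] [HasZeroMorphisms C] (M : C) : Prop :=
  ∃ (n : ℕ) (S : Fin n → C),
    (∀ i, Simple (S i)) ∧
    (∀ i j, Nonempty (S i ≅ S j) → i = j) ∧
    (∀ X : C, Simple X → ∃ i, Nonempty (X ≅ S i)) ∧
    ∃ b : Bicone S, Nonempty b.IsBilimit ∧ Nonempty (M ≅ b.pt)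

/-! ### The groupoid of colorings -/

/-- A coloring of `d` points by `ℓ` colors. The element `k : Fin ℓ` stands for the color `k + 1`. -/
@[ext] structure Coloring (ℓ d : ℕ) where
  color : Fin d → Fin ℓ

namespace Coloring

variable {ℓ d : ℕ}

/-- Morphisms `f ⟶ g` are the bijections `σ` of the set of points with `g ∘ σ = f`; the
composition `σ ≫ τ` is the map `τ ∘ σ`. -/
instance : Groupoid (Coloring ℓ d) where
  Hom f g := {σ : Equiv.Perm (Fin d) // g.color ∘ σ = f.color}
  id f := ⟨1, rfl⟩
  comp {f g h} σ τ := ⟨τ.1 * σ.1, by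
    funext x
    exact (congrFun τ.2 (σ.1 x)).trans (congrFun σ.2 x)⟩
  inv {f g} σ := ⟨σ.1⁻¹, by
    funext x
    exact (congrFun σ.2 (σ.1⁻¹ x)).symm.trans (congrArg g.color (σ.1.apply_symm_apply x))⟩
  id_comp σ := Subtype.ext (mul_one σ.1)
  comp_id σ := Subtype.ext (one_mul σ.1)
  assoc σ τ ρ := Subtype.ext (mul_assoc ρ.1 τ.1 σ.1).symm
  inv_comp σ := Subtype.ext (mul_inv_cancel σ.1)
  comp_inv σ := Subtype.ext (inv_mul_cancel σ.1)

/-- The bijection underlying a morphism. -/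
def toPerm {f g : Coloring ℓ d} (σ : f ⟶ g) : Equiv.Perm (Fin d) := σ.1

/-- A bijection `σ` as a morphism from `g ∘ σ` to `g`. -/
def pullback (σ : Equiv.Perm (Fin d)) (g : Coloring ℓ d) :
    (⟨g.color ∘ σ⟩ : Coloring ℓ d) ⟶ g := ⟨σ, rfl⟩

lemma hom_ext {f g : Coloring ℓ d} {σ τ : f ⟶ g} (h : toPerm σ = toPerm τ) : σ = τ :=
  Subtype.ext h

lemma toPerm_id (f : Coloring ℓ d) : toPerm (𝟙 f) = 1 := rfl

lemma toPerm_comp {f g h : Coloring ℓ d} (σ : f ⟶ g) (τ : g ⟶ h) :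
    toPerm (σ ≫ τ) = toPerm τ * toPerm σ := rfl

lemma toPerm_inv {f g : Coloring ℓ d} (σ : f ⟶ g) :
    toPerm (Groupoid.inv σ) = (toPerm σ)⁻¹ := rfl

instance (f g : Coloring ℓ d) : Finite (f ⟶ g) :=
  inferInstanceAs (Finite {σ : Equiv.Perm (Fin d) // g.color ∘ σ = f.color})

instance : Finite (Coloring ℓ d) :=
  Finite.of_injective Coloring.color fun _ _ => Coloring.ext

/-- The involutions (including the identity) in the group of endomorphisms of `f`. -/
@[ext] structure Involution (f : Coloring ℓ d) where
  hom : f ⟶ f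
  hom_comp_hom : hom ≫ hom = 𝟙 f

instance (f : Coloring ℓ d) : Finite (Involution f) :=
  Finite.of_injective Involution.hom fun _ _ => Involution.ext

/-- The conjugate `σ w σ⁻¹`. -/
def Involution.conj {f g : Coloring ℓ d} (σ : f ⟶ g) (w : Involution f) : Involution g :=
  ⟨Groupoid.inv σ ≫ w.hom ≫ σ, by
    have h := w.hom_comp_hom
    simp only [Category.assoc]
    rw [← Category.assoc σ, Groupoid.comp_inv, Category.id_comp, ← Category.assoc w.hom w.hom, h,
      Category.id_comp, Groupoid.inv_comp]⟩

end Coloring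

/-- The number of pairs `i < j` with `w i = j` and `σ i > σ j`. -/
def inversions {d : ℕ} (σ w : Equiv.Perm (Fin d)) : ℕ :=
  (Finset.univ.filter fun p : Fin d × Fin d => p.1 < p.2 ∧ w p.1 = p.2 ∧ σ p.2 < σ p.1).card

lemma inversions_one {d : ℕ} (w : Equiv.Perm (Fin d)) : inversions 1 w = 0 := by
  unfold inversions
  rw [Finset.card_eq_zero, Finset.filter_eq_empty_iff]
  rintro p - ⟨h1, -, h2⟩
  exact absurd h1 (not_lt.mpr (le_of_lt h2))

lemma neg_one_pow_inversions {d : ℕ} (σ w : Equiv.Perm (Fin d)) :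
    (-1 : ℂ) ^ inversions σ w =
      ∏ p ∈ Finset.univ.filter (fun p : Fin d × Fin d => p.1 < p.2 ∧ w p.1 = p.2),
        if σ p.2 < σ p.1 then (-1 : ℂ) else 1 := by
  rw [Finset.prod_ite, Finset.prod_const, Finset.prod_const_one, mul_one, Finset.filter_filter]
  simp only [inversions, and_assoc]

lemma neg_one_pow_inversions_mul {d : ℕ} (σ τ w : Equiv.Perm (Fin d)) (hw : w * w = 1) :
    (-1 : ℂ) ^ inversions (σ * τ) w = (-1) ^ inversions τ w * (-1) ^ inversions σ (τ * w * τ⁻¹) := by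
  have hww : ∀ x, w (w x) = x := fun x => by
    have := Equiv.congr_fun hw x
    simpa using this
  have key : (-1 : ℂ) ^ inversions σ (τ * w * τ⁻¹) =
      ∏ p ∈ Finset.univ.filter (fun p : Fin d × Fin d => p.1 < p.2 ∧ w p.1 = p.2),
        if (τ p.2 < τ p.1 ↔ σ (τ p.2) < σ (τ p.1)) then (1 : ℂ) else -1 := by
    rw [neg_one_pow_inversions]
    symm
    refine Finset.prod_bij
      (fun p _ => if τ p.2 < τ p.1 then (τ p.2, τ p.1) else (τ p.1, τ p.2)) ?_ ?_ ?_ ?_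
    · rintro ⟨i, j⟩ hp
      simp only [Finset.mem_filter, Finset.mem_univ, true_and] at hp ⊢
      obtain ⟨hij, rfl⟩ := hp
      have hne : τ i ≠ τ (w i) := fun h => absurd (τ.injective h) (ne_of_lt hij)
      split_ifs with h
      · simp [h, hww]
      · simp [lt_of_le_of_ne (not_lt.mp h) hne]
    · rintro ⟨i, j⟩ hp ⟨i', j'⟩ hp' h
      simp only [Finset.mem_filter, Finset.mem_univ, true_and] at hp hp'
      have h1 := hp.1
      have h2 := hp'.1
      split_ifs at h <;> simp only [Prod.mk.injEq, EmbeddingLike.apply_eq_iff_eq] at h ⊢ <;> grind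
    · rintro ⟨a, b⟩ hq
      simp only [Finset.mem_filter, Finset.mem_univ, true_and] at hq
      obtain ⟨hab, rfl⟩ := hq
      simp only [Equiv.Perm.mul_apply] at hab ⊢
      obtain ⟨i, rfl⟩ := τ.surjective a
      have hi0 : τ⁻¹ (τ i) = i := τ.symm_apply_apply i
      rw [hi0] at hab ⊢
      rcases lt_trichotomy i (w i) with hi | hi | hi
      · exact ⟨(i, w i), by simp [hi], by simp [not_lt.mpr (le_of_lt hab)]⟩
      · rw [← hi] at hab
        exact absurd hab (lt_irrefl _)
      · exact ⟨(w i, i), by simp [hi, hww], by simp [hab]⟩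
    · rintro ⟨i, j⟩ hp
      simp only [Finset.mem_filter, Finset.mem_univ, true_and] at hp
      have hne : τ i ≠ τ j := fun h => absurd (τ.injective h) (ne_of_lt hp.1)
      have hne' : σ (τ i) ≠ σ (τ j) := fun h => hne (σ.injective h)
      dsimp only
      by_cases h1 : τ j < τ i <;> by_cases h2 : σ (τ j) < σ (τ i) <;> simp [h1, h2] <;> order
  rw [key, neg_one_pow_inversions, neg_one_pow_inversions, ← Finset.prod_mul_distrib]
  refine Finset.prod_congr rfl fun p _ => ?_
  simp only [Equiv.Perm.mul_apply]
  by_cases h1 : τ p.2 < τ p.1 <;> by_cases h2 : σ (τ p.2) < σ (τ p.1) <;> simp [h1, h2]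

/-! ### Modules over the linearized groupoid -/

/-- The `ℂ`-linear category generated by the groupoid of colorings: morphisms are the formal
linear combinations of morphisms of colorings. -/
abbrev LinColoring (ℓ d : ℕ) := Free ℂ (Coloring ℓ d)

/-- The property of a functor to finite dimensional vector spaces of being `ℂ`-linear. -/
def isLinearFunctor (ℓ d : ℕ) : ObjectProperty (LinColoring ℓ d ⥤ FGModuleCat.{0} ℂ) :=
  fun F => F.Additive ∧ F.Linear ℂ

/-- The category of `ℂ`-linear functors from the linearized groupoid to finite dimensional complex
vector spaces, with natural transformations as morphisms. -/
abbrev ColoringModule (ℓ d : ℕ) := (isLinearFunctor ℓ d).FullSubcategory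

section Gelfand

variable {ℓ d : ℕ}

/-- The action of a morphism of colorings on involutions,
`w ↦ (-1) ^ inversions(σ, w) • σ w σ⁻¹`, extended linearly. -/
noncomputable def gelfandAction {f g : Coloring ℓ d} (σ : f ⟶ g) :
    (f.Involution →₀ ℂ) →ₗ[ℂ] (g.Involution →₀ ℂ) :=
  Finsupp.lsum ℂ fun w =>
    (-1 : ℂ) ^ inversions (Coloring.toPerm σ) (Coloring.toPerm w.hom) • Finsupp.lsingle (w.conj σ)

lemma gelfandAction_single {f g : Coloring ℓ d} (σ : f ⟶ g) (w : f.Involution) (c : ℂ) :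
    gelfandAction σ (Finsupp.single w c) =
      (-1 : ℂ) ^ inversions (Coloring.toPerm σ) (Coloring.toPerm w.hom) • Finsupp.single (w.conj σ) c := by
  simp [gelfandAction]

lemma gelfandAction_id (f : Coloring ℓ d) : gelfandAction (𝟙 f) = LinearMap.id := by
  refine Finsupp.lhom_ext fun w c => ?_
  have : w.conj (𝟙 f) = w := Coloring.Involution.ext (by
    simp [Coloring.Involution.conj])
  rw [gelfandAction_single, this, Coloring.toPerm_id, inversions_one]
  simp

lemma gelfandAction_comp {f g h : Coloring ℓ d} (τ : f ⟶ g) (σ : g ⟶ h) :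
    gelfandAction (τ ≫ σ) = gelfandAction σ ∘ₗ gelfandAction τ := by
  refine Finsupp.lhom_ext fun w c => ?_
  have hw : Coloring.toPerm w.hom * Coloring.toPerm w.1 = 1 := congrArg Coloring.toPerm w.hom_comp_hom
  have hc : (w.conj τ).conj σ = w.conj (τ ≫ σ) := Coloring.Involution.ext (Coloring.hom_ext (by
    simp [Coloring.Involution.conj, Coloring.toPerm_comp, mul_assoc]))
  have ht : Coloring.toPerm (w.conj τ).hom =
      Coloring.toPerm τ * Coloring.toPerm w.hom * (Coloring.toPerm τ)⁻¹ := rfl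
  rw [LinearMap.comp_apply, gelfandAction_single, gelfandAction_single, map_smul,
    gelfandAction_single, hc, ht, Coloring.toPerm_comp, neg_one_pow_inversions_mul _ _ _ hw,
    smul_smul]

/-- The linear combination of the maps `gelfandAction σ` with the coefficients of `φ`. -/
noncomputable def gelfandMap {f g : Coloring ℓ d} :
    ((f ⟶ g) →₀ ℂ) →ₗ[ℂ] (f.Involution →₀ ℂ) →ₗ[ℂ] (g.Involution →₀ ℂ) :=
  Finsupp.linearCombination ℂ gelfandAction

/-- An object of the linearized groupoid is a coloring. -/
def LinColoring.coloring (f : LinColoring ℓ d) : Coloring ℓ d := f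

lemma gelfandMap_single {f g : Coloring ℓ d} (σ : f ⟶ g) (c : ℂ) :
    gelfandMap (Finsupp.single σ c) = c • gelfandAction σ := by
  simp [gelfandMap]

lemma gelfandMap_comp {f g h : Coloring ℓ d} (φ : (f ⟶ g) →₀ ℂ) (ψ : (g ⟶ h) →₀ ℂ) :
    gelfandMap (φ.sum fun τ s => ψ.sum fun σ t => Finsupp.single (τ ≫ σ) (s * t)) =
      gelfandMap ψ ∘ₗ gelfandMap φ := by
  have e : ∀ {a b : Coloring ℓ d} (χ : (a ⟶ b) →₀ ℂ),
      gelfandMap χ = ∑ σ ∈ χ.support, χ σ • gelfandAction σ := fun χ => rfl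
  rw [e φ, e ψ]
  refine LinearMap.ext fun v => ?_
  simp only [Finsupp.sum, map_sum, gelfandMap_single, gelfandAction_comp, LinearMap.sum_apply,
    LinearMap.comp_apply, LinearMap.smul_apply, map_smul, Finset.smul_sum, smul_smul]

/-- The functor underlying the Gelfand module: it sends `f` to the vector space with basis the
involutions of the group of endomorphisms of `f`, and acts on morphisms by the linear extension of
`gelfandAction`. -/
noncomputable def gelfandFunctor (ℓ d : ℕ) : LinColoring ℓ d ⥤ FGModuleCat.{0} ℂ where
  obj f := FGModuleCat.of ℂ (f.coloring.Involution →₀ ℂ)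
  map {f g} φ := FGModuleCat.ofHom (gelfandMap (f := f.coloring) (g := g.coloring) φ)
  map_id f := by
    apply FGModuleCat.hom_ext
    refine (gelfandMap_single (𝟙 f.coloring) 1).trans ?_
    rw [one_smul, gelfandAction_id]
    rfl
  map_comp {f g h} φ ψ := by
    apply FGModuleCat.hom_ext
    exact gelfandMap_comp (f := f.coloring) (g := g.coloring) (h := h.coloring) φ ψ

/-- The Gelfand module of the linearized groupoid. -/
noncomputable def gelfandModule (ℓ d : ℕ) : ColoringModule ℓ d :=
  ⟨gelfandFunctor ℓ d,
    { map_add := fun {_ _ φ ψ} => FGModuleCat.hom_ext (map_add gelfandMap φ ψ) },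
    { map_smul := fun {_ _} φ c => FGModuleCat.hom_ext (map_smul gelfandMap c φ) }⟩

end Gelfand

/-! ### The wreath product -/

/-- The generalized symmetric group: the wreath product of the group of complex `ℓ`-th roots of
unity with the symmetric group on `d` letters, where `σ` acts on tuples by `(σ • a) i = a (σ⁻¹ i)`.
The element `(a, σ)` corresponds to the product of the diagonal matrix `a` and the permutation
matrix of `σ`. -/
abbrev GenSymm (ℓ d : ℕ) :=
  (Fin d → rootsOfUnity ℓ ℂ) ⋊[mulAutArrow] Equiv.Perm (Fin d)

section Wreath

variable {ℓ d : ℕ}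

/-- The scalar `∏ i, a i ^ g(i)` by which a diagonal matrix acts on the value at `g`, where the
colors are numbered from `1` to `ℓ`. -/
noncomputable def diagWeight (a : Fin d → rootsOfUnity ℓ ℂ) (g : Coloring ℓ d) : ℂ :=
  ∏ i, (((a i : ℂˣ) : ℂ)) ^ ((g.color i : ℕ) + 1)

/-- The value of a module over the linearized groupoid at a coloring. -/
abbrev ColoringModule.value (M : ColoringModule ℓ d) (f : Coloring ℓ d) : Type :=
  M.obj.obj (Free.of ℂ f)

/-- The action of a morphism of colorings on the values of a module. -/
noncomputable def ColoringModule.act (M : ColoringModule ℓ d) {f g : Coloring ℓ d} (σ : f ⟶ g) :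
    M.value f →ₗ[ℂ] M.value g :=
  (M.obj.map ((Free.embedding ℂ (Coloring ℓ d)).map σ)).hom.hom

lemma ColoringModule.act_id (M : ColoringModule ℓ d) (f : Coloring ℓ d) :
    M.act (𝟙 f) = LinearMap.id := by
  unfold ColoringModule.act
  exact congrArg (fun x : M.obj.obj (Free.of ℂ f) ⟶ M.obj.obj (Free.of ℂ f) => x.hom.hom)
    (M.obj.map_id (Free.of ℂ f))

lemma ColoringModule.act_comp (M : ColoringModule ℓ d) {f g h : Coloring ℓ d}
    (τ : f ⟶ g) (σ : g ⟶ h) : M.act (τ ≫ σ) = M.act σ ∘ₗ M.act τ := by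
  unfold ColoringModule.act
  rw [Functor.map_comp]
  exact congrArg (fun x : M.obj.obj (Free.of ℂ f) ⟶ M.obj.obj (Free.of ℂ h) => x.hom.hom)
    (M.obj.map_comp _ _)

/-- The representation of the generalized symmetric group on the direct sum `⨁ f, M f` attached
to a module `M` over the linearized groupoid. This is the restriction of `⨁ f, M f`, as a module
over the algebra `⨁ f g, ℂ[Hom(f, g)]`, along the homomorphism from the group algebra that sends a
permutation `σ` to the sum of all morphisms with underlying bijection `σ`, and a diagonal matrix
`a` to `∑ g, (∏ i, a i ^ g(i)) • 𝟙 g`. In particular `(a, σ)` maps `M (g ∘ σ)` to `M g`. -/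
noncomputable def wreathRep (M : ColoringModule ℓ d) :
    Representation ℂ (GenSymm ℓ d) ((f : Coloring ℓ d) → M.value f) where
  toFun s := LinearMap.pi fun g =>
    diagWeight s.left g • M.act (Coloring.pullback s.right g) ∘ₗ LinearMap.proj _
  map_one' := by
    refine LinearMap.ext fun v => funext fun g => ?_
    have h : diagWeight (1 : GenSymm ℓ d).left g = 1 := by simp [diagWeight]
    change diagWeight (1 : GenSymm ℓ d).left g • M.act (𝟙 g) (v g) = v g
    rw [h, M.act_id, one_smul]
    rfl
  map_mul' s t := by
    refine LinearMap.ext fun v => funext fun g => ?_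
    have h : diagWeight (s * t).left g =
        diagWeight s.left g * diagWeight t.left ⟨g.color ∘ s.right⟩ := by
      simp only [diagWeight, SemidirectProduct.mul_left, Pi.mul_apply, Subgroup.coe_mul,
        Units.val_mul, mul_pow, Finset.prod_mul_distrib]
      congr 1
      rw [← Equiv.prod_comp s.right (fun i =>
        (((mulAutArrow s.right t.left i : rootsOfUnity ℓ ℂ) : ℂˣ) : ℂ) ^
        ((g.color i : ℕ) + 1))]
      refine Finset.prod_congr rfl fun i _ => ?_
      have hi : s.right⁻¹ (s.right i) = i := s.right.symm_apply_apply i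
      change (((t.left (s.right⁻¹ (s.right i)) : ℂˣ) : ℂ)) ^ _ = _
      rw [hi]
      rfl
    change diagWeight (s * t).left g • M.act
        (Coloring.pullback t.right ⟨g.color ∘ s.right⟩ ≫ Coloring.pullback s.right g) (v _) =
      diagWeight s.left g • M.act (Coloring.pullback s.right g)
        (diagWeight t.left _ • M.act (Coloring.pullback t.right ⟨g.color ∘ s.right⟩) (v _))
    rw [h, M.act_comp, map_smul, smul_smul]
    rfl

/-- `wreathRep` as a finite dimensional representation. -/
noncomputable def wreathModule (M : ColoringModule ℓ d) : FDRep ℂ (GenSymm ℓ d) :=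
  FDRep.of (wreathRep M)

end Wreath

/-! ### Periods and cycles of a permutation. -/

section PermutationPeriods

variable {α : Type*}

/-! The group statement is proved first, by a twisted Frobenius–Schur argument, and is then carried
to the groupoid along an equivalence of categories.

Let `τ` be the automorphism of the wreath product that inverts diagonal matrices and keeps
permutations. A permutation is conjugate to its inverse by a permutation preserving its cycles, so
`V` twisted by `τ` has the character of the dual of `V`. For simple `V` the invariant bilinear forms
pairing `V` with its twist therefore span a line; transposition acts on it by a sign, and that sign
is the mean of `χ_V (τ g * g)`. If the character of `M` at `g` counts the solutions of `x * τ x =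
g`, this mean is also the multiplicity of `V` in `M`. A nonnegative integer that squares to one is
one, so every simple occurs exactly once (`FDRep.isGelfandModel_of_character`).

It remains to compare two counts. Character orthogonality on the diagonal group expresses the number
of solutions of `x * τ x = (a, σ)` as the sum over `f` of the weight of `a` at `f` times the number
of square roots of `σ` preserving `f`. The trace on the Gelfand module is the same sum, with the
signed number of involutions commuting with `σ` and preserving `f` in place of the square roots.
These agree (`sum_neg_one_pow_inversions`): if `w` preserves an even cycle of `σ`, multiplication by
the half turn of that cycle reverses the sign, so such terms cancel; every other `w` has sign one
and corresponds to one square root.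

The equivalence is the weight space decomposition: the colorings index the characters of the
diagonal group, and the permutations move the weight spaces as the groupoid prescribes. -/

lemma zpow_apply_eq_self_iff (σ : Equiv.Perm α) (i : α) (k : ℤ) :
    (σ ^ k) i = i ↔ (Function.minimalPeriod σ i : ℤ) ∣ k :=
  MulAction.zpow_smul_eq_iff_minimalPeriod_dvd (a := σ) (b := i)

lemma pow_apply_eq_self_iff (σ : Equiv.Perm α) (i : α) (k : ℕ) :
    (σ ^ k) i = i ↔ Function.minimalPeriod σ i ∣ k := by
  have := zpow_apply_eq_self_iff σ i k
  rwa [zpow_natCast, Int.natCast_dvd_natCast] at this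

lemma zpow_apply_eq_zpow_apply_iff (σ : Equiv.Perm α) (i : α) (k m : ℤ) :
    (σ ^ k) i = (σ ^ m) i ↔ (Function.minimalPeriod σ i : ℤ) ∣ k - m := by
  rw [← zpow_apply_eq_self_iff, sub_eq_neg_add, zpow_add, Equiv.Perm.mul_apply, zpow_neg,
    Equiv.Perm.inv_eq_iff_eq]

lemma pow_apply_eq_pow_apply_iff (σ : Equiv.Perm α) (i : α) (k m : ℕ) :
    (σ ^ k) i = (σ ^ m) i ↔ k ≡ m [MOD Function.minimalPeriod σ i] := by
  have := zpow_apply_eq_zpow_apply_iff σ i k m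
  rw [zpow_natCast, zpow_natCast] at this
  rw [this, Nat.ModEq.comm, Nat.modEq_iff_dvd]

lemma Equiv.Perm.SameCycle.minimalPeriod_eq {σ : Equiv.Perm α} {i j : α}
    (h : σ.SameCycle i j) : Function.minimalPeriod σ i = Function.minimalPeriod σ j := by
  obtain ⟨k, rfl⟩ := h
  refine Nat.dvd_antisymm ?_ ?_
  · rw [← pow_apply_eq_self_iff]
    have h := (pow_apply_eq_self_iff σ ((σ ^ k) i) _).2 dvd_rfl
    rw [← Equiv.Perm.mul_apply, ← zpow_natCast, ← zpow_add, add_comm, zpow_add,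
      Equiv.Perm.mul_apply] at h
    simpa using (σ ^ k).injective h
  · rw [← pow_apply_eq_self_iff, ← Equiv.Perm.mul_apply, ← zpow_natCast, ← zpow_add, add_comm,
      zpow_add, Equiv.Perm.mul_apply, zpow_natCast, (pow_apply_eq_self_iff σ i _).2 dvd_rfl]

lemma commute_zpow_apply {σ w : Equiv.Perm α} (h : σ * w = w * σ) (k : ℤ) (i : α) :
    w ((σ ^ k) i) = (σ ^ k) (w i) := by
  have : Commute (σ ^ k) w := (show Commute σ w from h).zpow_left k
  exact (Equiv.congr_fun this i).symm

lemma commute_pow_apply {σ w : Equiv.Perm α} (h : σ * w = w * σ) (k : ℕ) (i : α) :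
    w ((σ ^ k) i) = (σ ^ k) (w i) := by
  have := commute_zpow_apply h k i
  rwa [zpow_natCast] at this

lemma comp_zpow_apply {β : Type*} {σ : Equiv.Perm α} {f : α → β} (h : f ∘ σ = f) (k : ℤ) (i : α) :
    f ((σ ^ k) i) = f i := by
  have h1 : ∀ i, f (σ i) = f i := fun i => congrFun h i
  induction k generalizing i with
  | zero => simp
  | succ k ih => rw [zpow_add_one, Equiv.Perm.mul_apply, ih, h1]
  | pred k ih =>
    rw [zpow_sub_one, Equiv.Perm.mul_apply, ih, ← h1]
    exact congrArg f (σ.apply_symm_apply i)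

lemma cycleOf_pow_apply [DecidableEq α] [Fintype α] (σ : Equiv.Perm α) (i j : α) (n : ℕ) :
    (σ.cycleOf i ^ n) j = if σ.SameCycle i j then (σ ^ n) j else j := by
  induction n with
  | zero => simp
  | succ n ih =>
    rw [pow_succ', Equiv.Perm.mul_apply, ih, Equiv.Perm.cycleOf_apply]
    split_ifs with h1 h2
    · rw [pow_succ', Equiv.Perm.mul_apply]
    · simp [h1] at h2
    · rfl

/-- A distinguished point in the cycle of `σ` through `i`. -/
noncomputable def cycleRep (σ : Equiv.Perm α) (i : α) : α :=
  (Quotient.mk (Equiv.Perm.SameCycle.setoid σ) i).out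

lemma cycleRep_eq_iff (σ : Equiv.Perm α) (i j : α) :
    cycleRep σ i = cycleRep σ j ↔ σ.SameCycle i j := by
  unfold cycleRep
  rw [Quotient.out_inj]
  exact Quotient.eq (r := Equiv.Perm.SameCycle.setoid σ)

lemma sameCycle_cycleRep (σ : Equiv.Perm α) (i : α) : σ.SameCycle (cycleRep σ i) i :=
  Quotient.exact (s := Equiv.Perm.SameCycle.setoid σ)
    (Quotient.out_eq (Quotient.mk (Equiv.Perm.SameCycle.setoid σ) i))

end PermutationPeriods

/-! ### Signs of involutions in the centralizer of a permutation. -/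

section Signs

variable {d : ℕ}

/-- The sign recording whether `i < w i`. -/
noncomputable def orientation (w : Equiv.Perm (Fin d)) (i : Fin d) : ℂ :=
  if i < w i then 1 else -1

lemma orientation_mul_self (w : Equiv.Perm (Fin d)) (i : Fin d) :
    orientation w i * orientation w i = 1 := by
  unfold orientation; split_ifs <;> norm_num

/-- Here `T` picks one point from each 2-cycle of `w`. As `σ` commutes with `w`, the factor at `i`
is `-1` exactly when `σ` reverses the order of `i` and `w i`; passing to the other point flips both
orientations. The freedom in `T` is what the sign computations below exploit. -/
lemma neg_one_pow_inversions_eq_prod {σ w : Equiv.Perm (Fin d)} (hw : ∀ i, w (w i) = i)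
    (hc : σ * w = w * σ) (T : Finset (Fin d)) (hT : ∀ i ∈ T, w i ≠ i)
    (hT' : ∀ i, w i ≠ i → (i ∈ T ↔ w i ∉ T)) :
    (-1 : ℂ) ^ inversions σ w = ∏ i ∈ T, orientation w i * orientation w (σ i) := by
  have hcw : ∀ i, w (σ i) = σ (w i) := fun i => (Equiv.congr_fun hc i).symm
  rw [neg_one_pow_inversions]
  symm
  refine Finset.prod_bij (fun i _ => if i < w i then (i, w i) else (w i, i)) ?_ ?_ ?_ ?_
  · intro i hi
    have := hT i hi
    simp only [Finset.mem_filter, Finset.mem_univ, true_and]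
    split_ifs with h
    · simp [h]
    · simp only [hw, and_true]
      exact lt_of_le_of_ne (not_lt.1 h) this
  · intro i hi j hj h
    have h1 := hT' i (hT i hi)
    have := hw i
    have := hw j
    split_ifs at h <;> simp only [Prod.mk.injEq] at h <;> grind
  · rintro ⟨i, j⟩ h
    simp only [Finset.mem_filter, Finset.mem_univ, true_and] at h
    obtain ⟨h, rfl⟩ := h
    by_cases hi : i ∈ T
    · exact ⟨i, hi, by simp [h]⟩
    · have := (hT' i h.ne').not.1 hi
      rw [not_not] at this
      exact ⟨w i, this, by simp [hw, h.not_gt]⟩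
  · intro i hi
    have h0 := hT i hi
    have h1 : σ (w i) ≠ σ i := fun h => h0 (σ.injective h)
    unfold orientation
    rw [hcw]
    split_ifs <;> first | (norm_num; done) | (exfalso; order)

/-- Cycles that `w` preserves are fixed pointwise, so `T` can be a union of cycles of `σ`: from two
swapped cycles take the one with the smaller representative. Reindexing by `σ` then makes the
product a product of squares. -/
lemma neg_one_pow_inversions_eq_one {σ w : Equiv.Perm (Fin d)} (hw : ∀ i, w (w i) = i)
    (hc : σ * w = w * σ) (h : ∀ i, σ.SameCycle i (w i) → w i = i) :
    (-1 : ℂ) ^ inversions σ w = 1 := by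
  have hcw : ∀ i, w (σ i) = σ (w i) := fun i => (Equiv.congr_fun hc i).symm
  have hr : ∀ i, cycleRep σ (σ i) = cycleRep σ i := fun i => by
    rw [cycleRep_eq_iff]; simpa using Equiv.Perm.SameCycle.refl σ i
  rw [neg_one_pow_inversions_eq_prod hw hc
    (Finset.univ.filter fun i => cycleRep σ i < cycleRep σ (w i)), Finset.prod_mul_distrib]
  · have : ∏ i ∈ Finset.univ.filter (fun i => cycleRep σ i < cycleRep σ (w i)),
        orientation w (σ i) =
        ∏ i ∈ Finset.univ.filter (fun i => cycleRep σ i < cycleRep σ (w i)), orientation w i := by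
      rw [Finset.prod_filter, Finset.prod_filter, ← Equiv.prod_comp σ (fun i =>
        if cycleRep σ i < cycleRep σ (w i) then orientation w i else 1)]
      simp only [hr, hcw]
    rw [this, ← Finset.prod_mul_distrib]
    exact Finset.prod_eq_one fun i _ => orientation_mul_self w i
  · intro i hi hwi
    simp [hwi] at hi
  · intro i hi
    have : cycleRep σ i ≠ cycleRep σ (w i) := fun h' => hi (h i ((cycleRep_eq_iff σ _ _).1 h'))
    simp only [Finset.mem_filter, Finset.mem_univ, true_and, hw, not_lt]
    exact ⟨le_of_lt, fun h => lt_of_le_of_ne h this⟩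

lemma prod_range_mul_succ {a : ℕ → ℂ} (ha : ∀ n, a n * a n = 1) (n : ℕ) :
    ∏ j ∈ Finset.range n, a j * a (j + 1) = a 0 * a n := by
  induction n with
  | zero => simp [ha]
  | succ n ih =>
    rw [Finset.prod_range_succ, ih]
    linear_combination (a 0 * a (n + 1)) * ha n

/-- The power of the cycle of `σ` through `i` which is the half turn if the cycle has even length. -/
noncomputable def halfTurn (σ : Equiv.Perm (Fin d)) (i : Fin d) : Equiv.Perm (Fin d) :=
  σ.cycleOf i ^ (Function.minimalPeriod σ i / 2)

lemma halfTurn_apply (σ : Equiv.Perm (Fin d)) (i j : Fin d) :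
    halfTurn σ i j = if σ.SameCycle i j then (σ ^ (Function.minimalPeriod σ i / 2)) j else j :=
  cycleOf_pow_apply σ i j _

lemma sameCycle_halfTurn (σ : Equiv.Perm (Fin d)) (i j : Fin d) :
    σ.SameCycle j (halfTurn σ i j) := by
  rw [halfTurn_apply]
  split_ifs
  · simpa using Equiv.Perm.SameCycle.refl σ j
  · rfl

lemma halfTurn_halfTurn {σ : Equiv.Perm (Fin d)} {i : Fin d}
    (h : Even (Function.minimalPeriod σ i)) (j : Fin d) : halfTurn σ i (halfTurn σ i j) = j := by
  have h1 := sameCycle_halfTurn σ i j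
  by_cases hj : σ.SameCycle i j
  · rw [halfTurn_apply, if_pos (hj.trans h1), halfTurn_apply, if_pos hj, ← Equiv.Perm.mul_apply,
      ← pow_add, pow_apply_eq_self_iff, ← hj.minimalPeriod_eq]
    obtain ⟨k, hk⟩ := h
    exact ⟨1, by omega⟩
  · rw [halfTurn_apply σ i j, if_neg hj, halfTurn_apply, if_neg hj]

lemma halfTurn_comm {σ w : Equiv.Perm (Fin d)} (hc : σ * w = w * σ) {i : Fin d}
    (h : σ.SameCycle i (w i)) (j : Fin d) : w (halfTurn σ i j) = halfTurn σ i (w j) := by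
  have key : σ.SameCycle i (w j) ↔ σ.SameCycle i j := by
    obtain ⟨m, hm⟩ := h
    constructor
    · rintro ⟨k, hk⟩
      refine ⟨k - m, w.injective ?_⟩
      rw [commute_zpow_apply hc, ← hm, ← hk, ← Equiv.Perm.mul_apply, ← zpow_add, sub_add_cancel]
    · rintro ⟨k, rfl⟩
      exact ⟨k + m, by rw [commute_zpow_apply hc, zpow_add, Equiv.Perm.mul_apply, hm]⟩
  rw [halfTurn_apply, halfTurn_apply]
  simp only [key]
  split_ifs
  · rw [commute_pow_apply hc]
  · rfl

/-- The half turn adds the 2-cycles of `σ ^ j i` and `σ ^ (j + n / 2) i`, represented by `D` with `j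
< n / 2`. Their contribution telescopes to the orientations at the two ends `i` and `σ ^ (n / 2) i`,
which are opposite because these points are swapped. -/
lemma neg_one_pow_inversions_mul_halfTurn_of_fixed {σ w : Equiv.Perm (Fin d)}
    (hw : ∀ i, w (w i) = i) (hc : σ * w = w * σ) {i : Fin d} (hi : w i = i)
    (h : Even (Function.minimalPeriod σ i)) :
    (-1 : ℂ) ^ inversions σ (w * halfTurn σ i) = -(-1) ^ inversions σ w := by
  set c := halfTurn σ i with hcdef
  set n := Function.minimalPeriod σ i with hn
  have hpos : 0 < n := by
    have := (pow_apply_eq_self_iff σ i (orderOf σ)).1 (by rw [pow_orderOf_eq_one]; rfl)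
    exact Nat.pos_of_dvd_of_pos this (orderOf_pos σ)
  have hfix : ∀ j, σ.SameCycle i j → w j = j := by
    rintro j ⟨k, rfl⟩
    rw [commute_zpow_apply hc, hi]
  have hcomm : ∀ j, w (c j) = c (w j) := halfTurn_comm hc (by rw [hi])
  have hσ : ∀ j, σ (c j) = c (σ j) := halfTurn_comm rfl (by simpa using Equiv.Perm.SameCycle.refl σ i)
  have hcw : ∀ i, w (σ i) = σ (w i) := fun i => (Equiv.congr_fun hc i).symm
  have hw'C : ∀ j, σ.SameCycle i j → (w * c) j = (σ ^ (n / 2)) j := by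
    intro j hj
    rw [Equiv.Perm.mul_apply, hfix _ (hj.trans (sameCycle_halfTurn σ i j)), halfTurn_apply,
      if_pos hj]
  have hw'N : ∀ j, ¬ σ.SameCycle i j → (w * c) j = w j := by
    intro j hj
    rw [Equiv.Perm.mul_apply, hcdef, halfTurn_apply, if_neg hj]
  have hwN : ∀ j, ¬ σ.SameCycle i j → ¬ σ.SameCycle i (w j) := by
    intro j hj hj'
    have := hfix _ hj'
    rw [hw] at this
    exact hj (this ▸ hj')
  have hinv : ∀ j, (w * c) ((w * c) j) = j := by
    intro j
    rw [Equiv.Perm.mul_apply, Equiv.Perm.mul_apply, ← hcomm, halfTurn_halfTurn h, hw]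
  have hcom : σ * (w * c) = (w * c) * σ := by
    ext j
    simp only [Equiv.Perm.mul_apply]
    rw [← hcw, hσ]
  have hn2 : n / 2 + n / 2 = n := by obtain ⟨k, hk⟩ := h; omega
  set D := (Finset.range (n / 2)).image fun j => (σ ^ j) i with hD
  have hDC : ∀ j ∈ D, σ.SameCycle i j := by
    intro j hj
    obtain ⟨k, -, rfl⟩ := Finset.mem_image.1 hj
    simpa using Equiv.Perm.SameCycle.refl σ i
  have hmemD : ∀ k < n, ((σ ^ k) i ∈ D ↔ k < n / 2) := by
    intro k hk
    rw [hD, Finset.mem_image]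
    constructor
    · rintro ⟨m, hm, hmk⟩
      rw [Finset.mem_range] at hm
      rw [pow_apply_eq_pow_apply_iff] at hmk
      have := Nat.ModEq.eq_of_lt_of_lt hmk (by omega) hk
      omega
    · exact fun h => ⟨k, Finset.mem_range.2 h, rfl⟩
  set T := Finset.univ.filter fun j => j < w j with hT
  have hTC : ∀ j ∈ T, ¬ σ.SameCycle i j := by
    intro j hj hij
    simp [T, hfix j hij] at hj
  have hdisj : Disjoint T D := Finset.disjoint_left.2 fun j hj hj' => hTC j hj (hDC j hj')
  have hne : ∀ j, σ.SameCycle i j → (w * c) j ≠ j := by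
    intro j hj
    rw [hw'C j hj, Ne, pow_apply_eq_self_iff, ← hj.minimalPeriod_eq]
    intro hdvd
    have := Nat.le_of_dvd (by omega) hdvd
    omega
  rw [neg_one_pow_inversions_eq_prod hinv hcom (T ∪ D), Finset.prod_union hdisj,
    neg_one_pow_inversions_eq_prod hw hc T]
  · have h1 : ∏ j ∈ T, orientation (w * c) j * orientation (w * c) (σ j) =
        ∏ j ∈ T, orientation w j * orientation w (σ j) := by
      refine Finset.prod_congr rfl fun j hj => ?_
      have hj := hTC j hj
      unfold orientation
      rw [hw'N j hj, hw'N (σ j) (by simpa using hj)]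
    have h2 : ∏ j ∈ D, orientation (w * c) j * orientation (w * c) (σ j) = -1 := by
      rw [hD, Finset.prod_image]
      · have h3 : ∀ j, orientation (w * c) ((σ ^ j) i) * orientation (w * c) (σ ((σ ^ j) i)) =
            (fun j => orientation (w * c) ((σ ^ j) i)) j *
              (fun j => orientation (w * c) ((σ ^ j) i)) (j + 1) := fun j => by
          simp only [pow_succ', Equiv.Perm.mul_apply]
        rw [Finset.prod_congr rfl fun j _ => h3 j, prod_range_mul_succ
          (fun j => orientation_mul_self _ _)]
        have h4 := hw'C i (.refl _ _)
        have h5 := hne i (.refl _ _)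
        have h6 := hinv i
        simp only [pow_zero, Equiv.Perm.one_apply]
        rw [← h4]
        unfold orientation
        rw [h6]
        split_ifs <;> first | (norm_num; done) | (exfalso; order)
      · intro a ha b hb hab
        simp only [Finset.coe_range, Set.mem_Iio] at ha hb
        rw [pow_apply_eq_pow_apply_iff] at hab
        exact Nat.ModEq.eq_of_lt_of_lt hab (by omega) (by omega)
    rw [h1, h2, mul_neg_one]
  · intro j hj
    simpa using (Finset.mem_filter.1 hj).2.ne'
  · intro j hj
    simp only [hT, Finset.mem_filter, Finset.mem_univ, true_and, hw, not_lt]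
    exact ⟨le_of_lt, fun h => lt_of_le_of_ne h hj.symm⟩
  · intro j hj
    rcases Finset.mem_union.1 hj with hj | hj
    · rw [hw'N j (hTC j hj)]
      simpa using (Finset.mem_filter.1 hj).2.ne'
    · exact hne j (hDC j hj)
  · intro j hj
    by_cases hij : σ.SameCycle i j
    · have hjT : j ∉ T := fun hj => hTC j hj hij
      have hjT' : (w * c) j ∉ T := fun hj => hTC _ hj (by rw [hw'C j hij]; simpa using hij)
      simp only [Finset.mem_union, hjT, hjT', false_or]
      rw [hw'C j hij]
      obtain ⟨k, hk, rfl⟩ : ∃ k < n, (σ ^ k) i = j := by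
        obtain ⟨k, rfl⟩ := hij
        refine ⟨(k % n).toNat, ?_, ?_⟩
        · have := Int.emod_lt_of_pos k (by exact_mod_cast hpos : (0 : ℤ) < n)
          have := Int.emod_nonneg k (by exact_mod_cast hpos.ne' : (n : ℤ) ≠ 0)
          omega
        · have := Int.emod_nonneg k (by exact_mod_cast hpos.ne' : (n : ℤ) ≠ 0)
          rw [← zpow_natCast, Int.toNat_of_nonneg this, zpow_apply_eq_zpow_apply_iff]
          rw [← hn]
          exact ⟨-(k / n), by have := Int.emod_add_mul_ediv k n; linarith⟩
      rw [← Equiv.Perm.mul_apply, ← pow_add, hmemD k hk]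
      by_cases hk2 : k < n / 2
      · rw [hmemD _ (by omega)]; omega
      -- In the second half of the cycle the half turn wraps around, since `n / 2 + k` and `k - n /
      -- 2` differ by `n`.
      · have : (σ ^ (n / 2 + k)) i = (σ ^ (k - n / 2)) i := by
          rw [pow_apply_eq_pow_apply_iff, ← hn, Nat.ModEq.comm, Nat.modEq_iff_dvd' (by omega)]
          exact ⟨1, by omega⟩
        rw [this, hmemD _ (by omega)]; omega
    · rw [hw'N j hij] at hj ⊢
      have hjD : j ∉ D := fun hj => hij (hDC j hj)
      have hjD' : w j ∉ D := fun hj => hwN j hij (hDC _ hj)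
      simp only [Finset.mem_union, hjD, hjD', or_false, T, Finset.mem_filter, Finset.mem_univ,
        true_and, hw, not_lt]
      exact ⟨le_of_lt, fun h => lt_of_le_of_ne h hj.symm⟩

end Signs

/-! ### Signed involutions against square roots. -/

section SquareRoots

variable {d : ℕ} {β : Type*}

/-- The cycle of `σ` through `i` has even length and is preserved by `w`. -/
def EvenInvariantCycle (σ w : Equiv.Perm (Fin d)) (i : Fin d) : Prop :=
  σ.SameCycle i (w i) ∧ Even (Function.minimalPeriod σ i)

/-- A half turn preserves every cycle of `σ`. Hence `w` and its partner in the cancellation see the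
same even invariant cycles. -/
lemma evenInvariantCycle_mul_halfTurn {σ w : Equiv.Perm (Fin d)} (hc : σ * w = w * σ) {i : Fin d}
    (hi : σ.SameCycle i (w i)) (j : Fin d) :
    EvenInvariantCycle σ (w * halfTurn σ i) j ↔ EvenInvariantCycle σ w j := by
  unfold EvenInvariantCycle
  have : σ.SameCycle (w j) ((w * halfTurn σ i) j) := by
    rw [Equiv.Perm.mul_apply, halfTurn_comm hc hi]
    exact sameCycle_halfTurn σ i _
  exact and_congr_left' ⟨fun h => h.trans this.symm, fun h => h.trans this⟩

/-- On an invariant cycle of length `n`, `w` is some `σ ^ k`, and `w ^ 2 = 1` gives `n ∣ 2 * k`;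
with `n` odd this forces `n ∣ k`. -/
lemma fixed_of_not_evenInvariantCycle {σ w : Equiv.Perm (Fin d)} (hw : ∀ i, w (w i) = i)
    (hc : σ * w = w * σ) (h : ∀ i, ¬ EvenInvariantCycle σ w i) {i : Fin d}
    (hi : σ.SameCycle i (w i)) : w i = i ∧ Odd (Function.minimalPeriod σ i) := by
  have hodd : Odd (Function.minimalPeriod σ i) := by
    rw [← Nat.not_even_iff_odd]
    exact fun he => h i ⟨hi, he⟩
  refine ⟨?_, hodd⟩
  obtain ⟨k, hk⟩ := hi
  have h2 := hw i
  rw [← hk, commute_zpow_apply hc, ← hk, ← Equiv.Perm.mul_apply, ← zpow_add,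
    zpow_apply_eq_self_iff] at h2
  rw [← hk, zpow_apply_eq_self_iff]
  have hodd' : Odd (Function.minimalPeriod σ i : ℤ) := by exact_mod_cast hodd
  rw [← two_mul] at h2
  exact (Int.isCoprime_iff_gcd_eq_one.2 (by
    rw [Int.gcd_comm]; simpa [Int.gcd] using hodd)).dvd_of_dvd_mul_left h2

/-- If `w` does not fix `i`, it acts on the cycle as the half turn itself. Then `w * halfTurn σ i`
fixes `i`, and the fixed case applies with the two involutions exchanged. -/
lemma neg_one_pow_inversions_mul_halfTurn {σ w : Equiv.Perm (Fin d)} (hw : ∀ i, w (w i) = i)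
    (hc : σ * w = w * σ) {i : Fin d} (hi : EvenInvariantCycle σ w i) :
    (-1 : ℂ) ^ inversions σ (w * halfTurn σ i) = -(-1) ^ inversions σ w := by
  obtain ⟨hs, he⟩ := hi
  by_cases hwi : w i = i
  · exact neg_one_pow_inversions_mul_halfTurn_of_fixed hw hc hwi he
  · have hcomm : ∀ j, w (halfTurn σ i j) = halfTurn σ i (w j) := halfTurn_comm hc hs
    have hσ : ∀ j, σ (halfTurn σ i j) = halfTurn σ i (σ j) :=
      halfTurn_comm rfl (by simpa using Equiv.Perm.SameCycle.refl σ i)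
    have hcw : ∀ i, w (σ i) = σ (w i) := fun i => (Equiv.congr_fun hc i).symm
    have hwi' : (w * halfTurn σ i) i = i := by
      rw [Equiv.Perm.mul_apply, hcomm]
      have hs' := hs
      obtain ⟨k, hk⟩ := hs
      rw [halfTurn_apply, if_pos hs', ← hk, ← Equiv.Perm.mul_apply, ← zpow_natCast, ← zpow_add,
        zpow_apply_eq_self_iff]
      have h2 := hw i
      rw [← hk, commute_zpow_apply hc, ← hk, ← Equiv.Perm.mul_apply, ← zpow_add,
        zpow_apply_eq_self_iff] at h2
      rw [← hk, zpow_apply_eq_self_iff] at hwi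
      obtain ⟨m, hm⟩ := he
      obtain ⟨q, hq⟩ := h2
      rw [hm] at hq hwi ⊢
      have e1 : (m + m) / 2 = m := by omega
      rw [e1]
      push_cast at hq hwi ⊢
      have hk' : k = m * q := by
        have : k + k = m * q + m * q := by rw [hq]; ring
        omega
      subst hk'
      rcases Int.even_or_odd' q with ⟨t, rfl | rfl⟩
      · exact absurd ⟨t, by ring⟩ hwi
      · exact ⟨t + 1, by ring⟩
    have h := neg_one_pow_inversions_mul_halfTurn_of_fixed (σ := σ) (w := w * halfTurn σ i)
      (fun j => by
        rw [Equiv.Perm.mul_apply, Equiv.Perm.mul_apply, ← hcomm, halfTurn_halfTurn he, hw])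
      (by ext j; simp only [Equiv.Perm.mul_apply]; rw [← hcw, hσ]) hwi' he
    have hww : w * halfTurn σ i * halfTurn σ i = w := by
      ext j; simp only [Equiv.Perm.mul_apply, halfTurn_halfTurn he]
    rw [hww] at h
    rw [h, neg_neg]

open Classical in
/-- The involutions preserving `f` and commuting with `σ`. -/
noncomputable def commutingInvolutions (f : Fin d → β) (σ : Equiv.Perm (Fin d)) :
    Finset (Equiv.Perm (Fin d)) :=
  Finset.univ.filter fun w => (∀ i, w (w i) = i) ∧ σ * w = w * σ ∧ f ∘ w = f

lemma mem_commutingInvolutions {f : Fin d → β} {σ w : Equiv.Perm (Fin d)} :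
    w ∈ commutingInvolutions f σ ↔ (∀ i, w (w i) = i) ∧ σ * w = w * σ ∧ f ∘ w = f := by
  simp [commutingInvolutions]

open Classical in
lemma sum_evenInvariantCycle_eq_zero {f : Fin d → β} {σ : Equiv.Perm (Fin d)} (hf : f ∘ σ = f) :
    ∑ w ∈ (commutingInvolutions f σ).filter (fun w => ∃ i, EvenInvariantCycle σ w i),
      (-1 : ℂ) ^ inversions σ w = 0 := by
  -- The cycle to turn is chosen from the set of points on even invariant cycles, and depends on
  -- that set alone. The partner of `w` has the same set, so the same cycle is turned back.
  have hset : ∀ w ∈ (commutingInvolutions f σ).filter (fun w => ∃ i, EvenInvariantCycle σ w i),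
      {i | EvenInvariantCycle σ w i}.Nonempty := fun w hw => (Finset.mem_filter.1 hw).2
  have hsome : ∀ w hw, EvenInvariantCycle σ w (hset w hw).some := fun w hw => (hset w hw).some_mem
  have hsame : ∀ w hw, {i | EvenInvariantCycle σ (w * halfTurn σ (hset w hw).some) i} =
      {i | EvenInvariantCycle σ w i} := fun w hw => Set.ext fun j =>
    evenInvariantCycle_mul_halfTurn
      (mem_commutingInvolutions.1 (Finset.mem_filter.1 hw).1).2.1 (hsome w hw).1 j
  have hmem : ∀ w hw, w * halfTurn σ (hset w hw).some ∈
      (commutingInvolutions f σ).filter (fun w => ∃ i, EvenInvariantCycle σ w i) := by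
    intro w hw
    have h := mem_commutingInvolutions.1 (Finset.mem_filter.1 hw).1
    have hi := hsome w hw
    have hcomm := halfTurn_comm h.2.1 hi.1
    have hσ := halfTurn_comm (σ := σ) (w := σ) (i := (hset w hw).some) rfl
      (by simpa using Equiv.Perm.SameCycle.refl σ _)
    have hcw : ∀ i, w (σ i) = σ (w i) := fun i => (Equiv.congr_fun h.2.1 i).symm
    refine Finset.mem_filter.2 ⟨mem_commutingInvolutions.2 ⟨?_, ?_, ?_⟩, ?_⟩
    · intro j
      rw [Equiv.Perm.mul_apply, Equiv.Perm.mul_apply, ← hcomm, halfTurn_halfTurn hi.2, h.1]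
    · ext j
      simp only [Equiv.Perm.mul_apply]
      rw [← hcw, hσ]
    · funext j
      have h1 : ∀ j, f (w j) = f j := fun j => congrFun h.2.2 j
      simp only [Function.comp_apply, Equiv.Perm.mul_apply, h1]
      rw [halfTurn_apply]
      split_ifs
      · rw [← zpow_natCast, comp_zpow_apply hf]
      · rfl
    · exact ⟨_, (evenInvariantCycle_mul_halfTurn h.2.1 hi.1 _).2 hi⟩
  refine Finset.sum_involution (fun w hw => w * halfTurn σ (hset w hw).some) ?_ ?_ hmem ?_
  · intro w hw
    have h := mem_commutingInvolutions.1 (Finset.mem_filter.1 hw).1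
    rw [neg_one_pow_inversions_mul_halfTurn h.1 h.2.1 (hsome w hw), add_neg_cancel]
  · intro w hw _ heq
    have h := mem_commutingInvolutions.1 (Finset.mem_filter.1 hw).1
    have h1 := neg_one_pow_inversions_mul_halfTurn h.1 h.2.1 (hsome w hw)
    rw [heq] at h1
    have h2 : (-1 : ℂ) ^ inversions σ w ≠ 0 := pow_ne_zero _ (by norm_num)
    exact h2 (by linear_combination h1 / 2)
  · intro w hw
    have e : ∀ (s t : Set (Fin d)) (hs : s.Nonempty) (ht : t.Nonempty), s = t →
        hs.some = ht.some := by
      rintro s t hs ht rfl; rfl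
    change w * halfTurn σ (hset w hw).some *
      halfTurn σ (hset _ (hmem w hw)).some = w
    rw [e _ _ _ (hset w hw) (hsame w hw)]
    ext j
    simp only [Equiv.Perm.mul_apply, halfTurn_halfTurn (hsome w hw).2]

open Classical in
/-- The square roots of `σ` preserving `f`. -/
noncomputable def squareRoots (f : Fin d → β) (σ : Equiv.Perm (Fin d)) :
    Finset (Equiv.Perm (Fin d)) :=
  Finset.univ.filter fun x => (∀ i, x (x i) = σ i) ∧ f ∘ x = f

lemma mem_squareRoots {f : Fin d → β} {σ x : Equiv.Perm (Fin d)} :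
    x ∈ squareRoots f σ ↔ (∀ i, x (x i) = σ i) ∧ f ∘ x = f := by
  simp [squareRoots]

/-- Turn a square root of `σ` into an involution. -/
noncomputable def involutionOfRoot (σ : Equiv.Perm (Fin d)) (x : Equiv.Perm (Fin d)) (i : Fin d) :
    Fin d :=
  if cycleRep σ i = cycleRep σ (x i) then i
  else if cycleRep σ i < cycleRep σ (x i) then x i else σ.symm (x i)

/-- Turn an involution commuting with `σ` into a square root of `σ`. -/
noncomputable def rootOfInvolution (σ : Equiv.Perm (Fin d)) (w : Equiv.Perm (Fin d)) (i : Fin d) :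
    Fin d :=
  if cycleRep σ i = cycleRep σ (w i) then (σ ^ ((Function.minimalPeriod σ i + 1) / 2)) i
  else if cycleRep σ i < cycleRep σ (w i) then w i else σ (w i)

lemma cycleRep_apply (σ : Equiv.Perm (Fin d)) (i : Fin d) : cycleRep σ (σ i) = cycleRep σ i := by
  rw [cycleRep_eq_iff]; simpa using Equiv.Perm.SameCycle.refl σ i

lemma cycleRep_symm_apply (σ : Equiv.Perm (Fin d)) (i : Fin d) :
    cycleRep σ (σ.symm i) = cycleRep σ i := by
  rw [cycleRep_eq_iff]; simpa using Equiv.Perm.SameCycle.refl σ i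

lemma cycleRep_pow_apply (σ : Equiv.Perm (Fin d)) (n : ℕ) (i : Fin d) :
    cycleRep σ ((σ ^ n) i) = cycleRep σ i := by
  rw [cycleRep_eq_iff]; simpa using Equiv.Perm.SameCycle.refl σ i

lemma root_comm {σ x : Equiv.Perm (Fin d)} (hx : ∀ i, x (x i) = σ i) : σ * x = x * σ := by
  ext i
  simp only [Equiv.Perm.mul_apply, ← hx]

/-- A square root of `σ` preserving a cycle is the power `σ ^ ((n + 1) / 2)` on it. -/
lemma root_apply_of_sameCycle {σ x : Equiv.Perm (Fin d)} (hx : ∀ i, x (x i) = σ i) {i : Fin d}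
    (h : cycleRep σ i = cycleRep σ (x i)) :
    Odd (Function.minimalPeriod σ i) ∧
      x i = (σ ^ ((Function.minimalPeriod σ i + 1) / 2)) i := by
  obtain ⟨k, hk⟩ := (cycleRep_eq_iff σ _ _).1 h
  have h2 := hx i
  rw [← hk, commute_zpow_apply (root_comm hx), ← hk, ← Equiv.Perm.mul_apply, ← zpow_add] at h2
  have h3 : (σ ^ (k + k)) i = (σ ^ (1 : ℤ)) i := by simpa using h2
  rw [zpow_apply_eq_zpow_apply_iff] at h3
  have hodd : Odd (Function.minimalPeriod σ i : ℤ) := by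
    rw [← Int.not_even_iff_odd]
    intro he
    have := (he.two_dvd.trans h3)
    omega
  have hodd' : Odd (Function.minimalPeriod σ i) := by exact_mod_cast hodd
  refine ⟨hodd', ?_⟩
  rw [← hk, ← zpow_natCast, zpow_apply_eq_zpow_apply_iff]
  obtain ⟨m, hm⟩ := hodd'
  obtain ⟨q, hq⟩ := h3
  rw [hm] at hq ⊢
  have e1 : (2 * m + 1 + 1) / 2 = m + 1 := by omega
  rw [e1]
  push_cast at hq ⊢
  have hq' : Odd q ∨ Even q := (Int.even_or_odd q).symm
  -- With `n = 2 * m + 1` and `2 * k - 1 = n * (2 * t + 1)`, one gets `k - (m + 1) = n * t`; an even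
  -- quotient contradicts parity.
  rcases hq' with ⟨t, rfl⟩ | ⟨t, rfl⟩
  · exact ⟨t, by linarith⟩
  · exfalso
    have : k + k - 1 = 2 * ((2 * m + 1) * t) := by rw [hq]; ring
    omega

lemma involutionOfRoot_involutive {σ x : Equiv.Perm (Fin d)} (hx : ∀ i, x (x i) = σ i)
    (i : Fin d) : involutionOfRoot σ x (involutionOfRoot σ x i) = i := by
  have hxi : ∀ j, x (σ.symm j) = σ.symm (x j) := fun j => by
    rw [Equiv.eq_symm_apply, ← hx, hx (σ.symm j), σ.apply_symm_apply]
  have hinv : ∀ j, σ.symm (σ j) = j := σ.symm_apply_apply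
  unfold involutionOfRoot
  by_cases h1 : cycleRep σ i = cycleRep σ (x i)
  · simp [h1]
  · rcases lt_or_gt_of_ne h1 with h2 | h2
    · simp [h1, h2, hx, cycleRep_apply, Ne.symm h1, h2.not_gt, hinv]
    · simp [h1, h2.not_gt, hxi, hx, cycleRep_symm_apply, Ne.symm h1, h2, hinv]

lemma rootOfInvolution_rootOfInvolution {σ w : Equiv.Perm (Fin d)} (hw : ∀ i, w (w i) = i)
    (hc : σ * w = w * σ)
    (hodd : ∀ i, σ.SameCycle i (w i) → w i = i ∧ Odd (Function.minimalPeriod σ i)) (i : Fin d) :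
    rootOfInvolution σ w (rootOfInvolution σ w i) = σ i := by
  have hcw : ∀ i, w (σ i) = σ (w i) := fun i => (Equiv.congr_fun hc i).symm
  unfold rootOfInvolution
  by_cases h1 : cycleRep σ i = cycleRep σ (w i)
  · have h2 := hodd i ((cycleRep_eq_iff σ _ _).1 h1)
    set m := (Function.minimalPeriod σ i + 1) / 2 with hm
    have h3 : Function.minimalPeriod σ ((σ ^ m) i) = Function.minimalPeriod σ i := by
      refine (Equiv.Perm.SameCycle.minimalPeriod_eq ?_).symm
      simpa using Equiv.Perm.SameCycle.refl σ i
    simp only [h1, if_true, commute_pow_apply hc, cycleRep_pow_apply, h3]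
    rw [← hm, ← Equiv.Perm.mul_apply, ← pow_add]
    have h4 : m + m = 1 + Function.minimalPeriod σ i := by
      obtain ⟨k, hk⟩ := h2.2
      omega
    rw [h4, pow_add, Equiv.Perm.mul_apply, (pow_apply_eq_self_iff σ i _).2 dvd_rfl, pow_one]
  · rcases lt_or_gt_of_ne h1 with h2 | h2
    · simp [h1, h2, hw, Ne.symm h1, h2.not_gt]
    · simp [h1, h2.not_gt, hcw, hw, cycleRep_apply, Ne.symm h1, h2]

open Classical in
-- On a cycle it preserves, a square root is forced, and the involution is forced to be the identity
-- there. On two swapped cycles, root and involution agree from the cycle with smaller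
-- representative to the other; on the way back they differ by one factor `σ`.
lemma card_not_evenInvariantCycle {f : Fin d → β} {σ : Equiv.Perm (Fin d)} (hf : f ∘ σ = f) :
    ((commutingInvolutions f σ).filter (fun w => ¬ ∃ i, EvenInvariantCycle σ w i)).card =
      (squareRoots f σ).card := by
  have hfσ : ∀ i, f (σ i) = f i := fun i => congrFun hf i
  have hfσ' : ∀ i, f (σ.symm i) = f i := fun i => by
    rw [← hfσ, σ.apply_symm_apply]
  have hodd : ∀ w ∈ (commutingInvolutions f σ).filter
      (fun w => ¬ ∃ i, EvenInvariantCycle σ w i),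
      ∀ i, σ.SameCycle i (w i) → w i = i ∧ Odd (Function.minimalPeriod σ i) := by
    intro w hw i hi
    obtain ⟨hw, hn⟩ := Finset.mem_filter.1 hw
    have h := mem_commutingInvolutions.1 hw
    exact fixed_of_not_evenInvariantCycle h.1 h.2.1 (not_exists.1 hn) hi
  have hroot : ∀ w ∈ (commutingInvolutions f σ).filter
      (fun w => ¬ ∃ i, EvenInvariantCycle σ w i), ∀ i,
      rootOfInvolution σ w (rootOfInvolution σ w i) = σ i := by
    intro w hw
    have h := mem_commutingInvolutions.1 (Finset.mem_filter.1 hw).1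
    exact rootOfInvolution_rootOfInvolution h.1 h.2.1 (hodd w hw)
  have hbij : ∀ w ∈ (commutingInvolutions f σ).filter
      (fun w => ¬ ∃ i, EvenInvariantCycle σ w i),
      Function.Bijective (rootOfInvolution σ w) := by
    intro w hw
    rw [← Finite.injective_iff_bijective]
    intro i j hij
    have := congrArg (rootOfInvolution σ w) hij
    rwa [hroot w hw, hroot w hw, σ.apply_eq_iff_eq] at this
  refine Finset.card_bij' (fun w hw => Equiv.ofBijective _ (hbij w hw))
    (fun x hx => (show Function.Involutive (involutionOfRoot σ x) from
      involutionOfRoot_involutive (mem_squareRoots.1 hx).1).toPerm) ?_ ?_ ?_ ?_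
  · intro w hw
    have h := mem_commutingInvolutions.1 (Finset.mem_filter.1 hw).1
    have hfw : ∀ i, f (w i) = f i := fun i => congrFun h.2.2 i
    refine mem_squareRoots.2 ⟨hroot w hw, ?_⟩
    funext i
    simp only [Function.comp_apply, Equiv.ofBijective_apply, rootOfInvolution]
    split_ifs
    · rw [← zpow_natCast, comp_zpow_apply hf]
    · exact hfw i
    · rw [hfσ, hfw]
  · intro x hx
    obtain ⟨hx, hfx⟩ := mem_squareRoots.1 hx
    have hfx' : ∀ i, f (x i) = f i := fun i => congrFun hfx i
    have hσx : ∀ i, x (σ i) = σ (x i) := fun i => (Equiv.congr_fun (root_comm hx) i).symm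
    have hinv : ∀ j, σ.symm (σ j) = j := σ.symm_apply_apply
    have hinv' : ∀ j, σ (σ.symm j) = j := σ.apply_symm_apply
    refine Finset.mem_filter.2 ⟨mem_commutingInvolutions.2
      ⟨involutionOfRoot_involutive hx, ?_, ?_⟩, ?_⟩
    · ext i
      simp only [Equiv.Perm.mul_apply, Function.Involutive.coe_toPerm, involutionOfRoot, hσx,
        cycleRep_apply]
      split_ifs
      · rfl
      · rfl
      · rw [hinv, hinv']
    · funext i
      simp only [Function.comp_apply, Function.Involutive.coe_toPerm, involutionOfRoot]
      split_ifs
      · rfl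
      · exact hfx' i
      · rw [hfσ', hfx']
    · rintro ⟨i, h1, h2⟩
      simp only [Function.Involutive.coe_toPerm, involutionOfRoot] at h1
      split_ifs at h1 with h3 h4
      · exact Nat.not_even_iff_odd.2 (root_apply_of_sameCycle hx h3).1 h2
      · exact h3 ((cycleRep_eq_iff σ _ _).2 h1)
      · exact h3 (((cycleRep_eq_iff σ _ _).2 h1).trans (cycleRep_symm_apply σ _))
  · intro w hw
    have h := mem_commutingInvolutions.1 (Finset.mem_filter.1 hw).1
    have hinv : ∀ j, σ.symm (σ j) = j := σ.symm_apply_apply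
    ext i
    simp only [Function.Involutive.coe_toPerm, involutionOfRoot, Equiv.ofBijective_apply,
      rootOfInvolution]
    by_cases h1 : cycleRep σ i = cycleRep σ (w i)
    · simp only [h1, if_true, cycleRep_pow_apply]
      rw [(hodd w hw i ((cycleRep_eq_iff σ _ _).1 h1)).1]
    · rcases lt_or_gt_of_ne h1 with h2 | h2
      · simp [h1, h2]
      · simp [h1, h2.not_gt, cycleRep_apply, hinv]
  · intro x hx
    obtain ⟨hx, -⟩ := mem_squareRoots.1 hx
    have hinv' : ∀ j, σ (σ.symm j) = j := σ.apply_symm_apply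
    ext i
    simp only [Function.Involutive.coe_toPerm, involutionOfRoot, Equiv.ofBijective_apply,
      rootOfInvolution]
    by_cases h1 : cycleRep σ i = cycleRep σ (x i)
    · simp only [if_pos h1, if_true]
      rw [← (root_apply_of_sameCycle hx h1).2]
    · rcases lt_or_gt_of_ne h1 with h2 | h2
      · simp [h1, h2]
      · simp [h1, h2.not_gt, cycleRep_symm_apply, hinv']

/-- The signed number of involutions commuting with `σ` is the number of square roots of `σ`. -/
theorem sum_neg_one_pow_inversions {f : Fin d → β} {σ : Equiv.Perm (Fin d)} (hf : f ∘ σ = f) :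
    ∑ w ∈ commutingInvolutions f σ, (-1 : ℂ) ^ inversions σ w = (squareRoots f σ).card := by
  classical
  rw [← Finset.sum_filter_add_sum_filter_not _ (fun w => ∃ i, EvenInvariantCycle σ w i),
    sum_evenInvariantCycle_eq_zero hf, zero_add, ← card_not_evenInvariantCycle hf,
    Finset.sum_congr rfl (g := fun _ => (1 : ℂ))]
  · simp
  · intro w hw
    obtain ⟨hw, hn⟩ := Finset.mem_filter.1 hw
    have h := mem_commutingInvolutions.1 hw
    exact neg_one_pow_inversions_eq_one h.1 h.2.1 fun i hi =>
      (fixed_of_not_evenInvariantCycle h.1 h.2.1 (not_exists.1 hn) hi).1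

end SquareRoots

/-! ### Semisimplicity and multiplicities in a linear category. -/

section SimpleDecomposition

variable {C : Type*} [Category* C] [Preadditive C]

/-- A decomposition of `V` as a finite direct sum of simple objects. -/
structure SimpleDecomposition (V : C) where
  ι : Type
  [fintype : Fintype ι]
  S : ι → C
  inj (i : ι) : S i ⟶ V
  proj (i : ι) : V ⟶ S i
  simple (i : ι) : Simple (S i)
  inj_proj (i : ι) : inj i ≫ proj i = 𝟙 (S i)
  inj_proj_of_ne (i j : ι) (h : i ≠ j) : inj i ≫ proj j = 0
  total : ∑ i, proj i ≫ inj i = 𝟙 V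

attribute [instance] SimpleDecomposition.fintype

namespace SimpleDecomposition

lemma nonempty_of_eq_zero {V : C} (h : 𝟙 V = 0) : Nonempty (SimpleDecomposition V) :=
  ⟨{ ι := Empty
     S := fun i => i.elim
     inj := fun i => i.elim
     proj := fun i => i.elim
     simple := fun i => i.elim
     inj_proj := fun i => i.elim
     inj_proj_of_ne := fun i => i.elim
     total := by simp [h] }⟩

lemma nonempty_of_simple (V : C) [h : Simple V] : Nonempty (SimpleDecomposition V) :=
  ⟨{ ι := Unit
     S := fun _ => V
     inj := fun _ => 𝟙 V
     proj := fun _ => 𝟙 V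
     simple := fun _ => h
     inj_proj := fun _ => Category.comp_id _
     inj_proj_of_ne := fun i j h => absurd (Subsingleton.elim i j) h
     total := by simp }⟩

/-- The decomposition of a direct sum. -/
def sum {V Y Z : C} {i₁ : Y ⟶ V} {p₁ : V ⟶ Y} {i₂ : Z ⟶ V} {p₂ : V ⟶ Z}
    (h₁₁ : i₁ ≫ p₁ = 𝟙 Y) (h₂₂ : i₂ ≫ p₂ = 𝟙 Z) (h₁₂ : i₁ ≫ p₂ = 0) (h₂₁ : i₂ ≫ p₁ = 0)
    (h : p₁ ≫ i₁ + p₂ ≫ i₂ = 𝟙 V) (D : SimpleDecomposition Y) (E : SimpleDecomposition Z) :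
    SimpleDecomposition V where
  ι := D.ι ⊕ E.ι
  S := Sum.elim D.S E.S
  inj := Sum.rec (fun i => D.inj i ≫ i₁) (fun i => E.inj i ≫ i₂)
  proj := Sum.rec (fun i => p₁ ≫ D.proj i) (fun i => p₂ ≫ E.proj i)
  simple := by
    rintro (i | i)
    · exact D.simple i
    · exact E.simple i
  inj_proj := by
    rintro (i | i)
    · simp [reassoc_of% h₁₁, D.inj_proj]
    · simp [reassoc_of% h₂₂, E.inj_proj]
  inj_proj_of_ne := by
    rintro (i | i) (j | j) hij
    · simp [reassoc_of% h₁₁, D.inj_proj_of_ne i j (fun h => hij (congrArg _ h))]; rfl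
    · simp [reassoc_of% h₁₂]; rfl
    · simp [reassoc_of% h₂₁]; rfl
    · simp [reassoc_of% h₂₂, E.inj_proj_of_ne i j (fun h => hij (congrArg _ h))]; rfl
  total := by
    have e₁ : ∑ i, (p₁ ≫ D.proj i) ≫ D.inj i ≫ i₁ = p₁ ≫ i₁ := by
      have := congrArg (fun f => p₁ ≫ f ≫ i₁) D.total
      simpa [Preadditive.sum_comp, Preadditive.comp_sum] using this
    have e₂ : ∑ i, (p₂ ≫ E.proj i) ≫ E.inj i ≫ i₂ = p₂ ≫ i₂ := by
      have := congrArg (fun f => p₂ ≫ f ≫ i₂) E.total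
      simpa [Preadditive.sum_comp, Preadditive.comp_sum] using this
    rw [← h, Fintype.sum_sum_type, ← e₁, ← e₂]
    rfl

section Linear

variable (k : Type*) [Field k] [Linear k C] [∀ X Y : C, FiniteDimensional k (X ⟶ Y)]

/-- The map `φ ↦ p ≫ φ ≫ i` embeds `End Y` in `End V`. Its image is fixed by composing with the
idempotent `p ≫ i`, so it misses the identity. This is the measure for the induction in
`nonempty_of_split`. -/
lemma finrank_end_lt_of_retract {Y V : C} {i : Y ⟶ V} {p : V ⟶ Y} (h : i ≫ p = 𝟙 Y)
    (hn : p ≫ i ≠ 𝟙 V) : Module.finrank k (Y ⟶ Y) < Module.finrank k (V ⟶ V) := by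
  let F : (Y ⟶ Y) →ₗ[k] (V ⟶ V) := Linear.leftComp k V p ∘ₗ Linear.rightComp k Y i
  have hF : ∀ φ, F φ = p ≫ φ ≫ i := fun φ => rfl
  have hinj : Function.Injective F := by
    intro φ ψ hφ
    have := congrArg (fun f => i ≫ f ≫ p) hφ
    simpa [hF, reassoc_of% h, h] using this
  have hlt : LinearMap.range F < ⊤ := by
    refine lt_top_iff_ne_top.2 fun htop => hn ?_
    obtain ⟨φ, hφ⟩ := LinearMap.range_eq_top.1 htop (𝟙 V)
    have h1 : p ≫ i ≫ p ≫ φ ≫ i = p ≫ φ ≫ i := by rw [reassoc_of% h]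
    rw [hF] at hφ
    rw [hφ] at h1
    simpa using h1
  rw [← LinearMap.finrank_range_of_inj hinj]
  exact Submodule.finrank_lt hlt.ne

/-- Morphisms into a direct sum. -/
def homEquiv {V : C} (D : SimpleDecomposition V) (X : C) : (X ⟶ V) ≃ₗ[k] (∀ i, X ⟶ D.S i) where
  toFun f i := f ≫ D.proj i
  map_add' f g := funext fun i => Preadditive.add_comp _ _ _ f g _
  map_smul' c f := funext fun i => Linear.smul_comp _ _ _ c f _
  invFun g := ∑ i, g i ≫ D.inj i
  left_inv f := by
    simp only [Category.assoc]
    rw [← Preadditive.comp_sum, D.total, Category.comp_id]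
  right_inv g := by
    funext j
    change (∑ i, g i ≫ D.inj i) ≫ D.proj j = g j
    rw [Preadditive.sum_comp, Finset.sum_eq_single j]
    · rw [Category.assoc, D.inj_proj, Category.comp_id]
    · intro i _ hij
      rw [Category.assoc, D.inj_proj_of_ne i j hij, comp_zero]
    · simp

open Classical in
lemma finrank_hom [IsAlgClosed k] [HasKernels C] {V : C} (D : SimpleDecomposition V) (X : C)
    [Simple X] :
    Module.finrank k (X ⟶ V) = (Finset.univ.filter fun i => Nonempty (X ≅ D.S i)).card := by
  rw [(D.homEquiv k X).finrank_eq, Module.finrank_pi_fintype, Finset.card_filter]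
  refine Finset.sum_congr rfl fun i _ => ?_
  have := D.simple i
  exact finrank_hom_simple_simple k X (D.S i)

/-- An object which contains every simple object with multiplicity one is a Gelfand model. -/
theorem isGelfandModel [IsAlgClosed k] [HasKernels C] {V : C} (D : SimpleDecomposition V)
    (h : ∀ (X : C) [Simple X], Module.finrank k (X ⟶ V) = 1) : IsGelfandModel V := by
  classical
  have h1 : ∀ (X : C) [Simple X], ∃! i, Nonempty (X ≅ D.S i) := by
    intro X _
    have := h X
    rw [D.finrank_hom k X, Finset.card_eq_one] at this
    obtain ⟨i, hi⟩ := this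
    have hi' : ∀ j, Nonempty (X ≅ D.S j) ↔ j = i := fun j => by
      simpa using Finset.ext_iff.1 hi j
    exact ⟨i, (hi' i).2 rfl, fun j hj => (hi' j).1 hj⟩
  let e := Fintype.equivFin D.ι
  refine ⟨Fintype.card D.ι, fun i => D.S (e.symm i), fun i => D.simple _, ?_, ?_, ?_⟩
  · intro i j hij
    have := D.simple (e.symm i)
    exact e.symm.injective ((h1 (D.S (e.symm i))).unique ⟨Iso.refl _⟩ hij)
  · intro X _
    obtain ⟨i, hi, -⟩ := h1 X
    exact ⟨e i, by simpa using hi⟩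
  · let b : Bicone (fun i => D.S (e.symm i)) :=
      { pt := V
        π := fun i => D.proj _
        ι := fun i => D.inj _
        ι_π := fun i j => by
          split_ifs with hij
          · subst hij
            simpa using D.inj_proj _
          · exact D.inj_proj_of_ne _ _ fun h => hij (e.symm.injective h) }
    refine ⟨b, ⟨isBilimitOfTotal b ?_⟩, ⟨Iso.refl _⟩⟩
    rw [← D.total, ← Equiv.sum_comp e.symm]

end Linear

/-- If all monomorphisms split, every object is a finite direct sum of simple objects. -/
theorem nonempty_of_split (k : Type*) [Field k] [Linear k C]
    [∀ X Y : C, FiniteDimensional k (X ⟶ Y)] [HasKernels C]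
    (hsplit : ∀ (X Y : C) (f : X ⟶ Y) [Mono f], IsSplitMono f) (V : C) : Nonempty (SimpleDecomposition V) := by
  by_cases h0 : 𝟙 V = 0
  · exact nonempty_of_eq_zero h0
  by_cases hs : Simple V
  · exact nonempty_of_simple V
  obtain ⟨Y, i, hi, hne, hniso⟩ : ∃ (Y : C) (i : Y ⟶ V), Mono i ∧ i ≠ 0 ∧ ¬ IsIso i := by
    by_contra hcon
    push Not at hcon
    refine hs ⟨fun {Y} f hf => ⟨fun hiso hf0 => h0 ?_, hcon Y f hf⟩⟩
    rw [← IsIso.inv_hom_id f, (cancel_epi (inv f)).2 hf0, comp_zero]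
  have := hsplit _ _ i
  set p := retraction i with hp
  have h11 : i ≫ p = 𝟙 Y := IsSplitMono.id i
  have hn : p ≫ i ≠ 𝟙 V := fun h => hniso ⟨p, h11, h⟩
  -- The complement of `Y` is the kernel of the retraction, with projection induced by the
  -- complementary idempotent.
  let q : V ⟶ kernel p := kernel.lift p (𝟙 V - p ≫ i) (by simp [h11])
  have hq : q ≫ kernel.ι p = 𝟙 V - p ≫ i := kernel.lift_ι _ _ _
  have h22 : kernel.ι p ≫ q = 𝟙 _ := by
    rw [← cancel_mono (kernel.ι p), Category.assoc, hq]
    simp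
  have h12 : i ≫ q = 0 := by
    rw [← cancel_mono (kernel.ι p), Category.assoc, hq]
    simp [reassoc_of% h11]
  have h21 : kernel.ι p ≫ p = 0 := kernel.condition p
  have htot : p ≫ i + q ≫ kernel.ι p = 𝟙 V := by rw [hq]; abel
  have hn' : q ≫ kernel.ι p ≠ 𝟙 V := fun h => hne (by
    rw [hq, sub_eq_self] at h
    rw [← Category.id_comp i, ← h11, Category.assoc, h, comp_zero])
  have lt1 := finrank_end_lt_of_retract k h11 hn
  have lt2 := finrank_end_lt_of_retract k h22 hn'
  obtain ⟨D⟩ := nonempty_of_split k hsplit Y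
  obtain ⟨E⟩ := nonempty_of_split k hsplit (kernel p)
  exact ⟨sum h11 h22 h12 h21 htot D E⟩
termination_by Module.finrank k (V ⟶ V)

end SimpleDecomposition

end SimpleDecomposition

/-! ### Multiplicity one for representations of a finite group. -/

section FrobeniusSchur

open Matrix

variable {G : Type} [Group G] [Finite G]

/-- By Maschke's theorem every object is injective, so monomorphisms split. -/
theorem FDRep.isGelfandModel_of_finrank_hom (M : FDRep ℂ G)
    (h : ∀ (X : FDRep ℂ G) [Simple X], Module.finrank ℂ (X ⟶ M) = 1) : IsGelfandModel M := by
  have : NeZero (Nat.card G : ℂ) := ⟨Nat.cast_ne_zero.2 Nat.card_pos.ne'⟩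
  obtain ⟨D⟩ := SimpleDecomposition.nonempty_of_split (C := FDRep ℂ G) ℂ
    (fun _ _ f _ => ⟨⟨Injective.factorThru (𝟙 _) f, Injective.comp_factorThru _ _⟩⟩) M
  exact D.isGelfandModel ℂ h

end FrobeniusSchur

/-! ### The twisted Frobenius–Schur indicator. -/

section TwistedFrobeniusSchur

open Matrix

variable {n : Type*} [Fintype n] [DecidableEq n]

/-- The map `A ↦ P * A * Q`. -/
def sandwich (P Q : Matrix n n ℂ) : Matrix n n ℂ →ₗ[ℂ] Matrix n n ℂ where
  toFun A := P * A * Q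
  map_add' A B := by rw [Matrix.mul_add, Matrix.add_mul]
  map_smul' c A := by simp

lemma sandwich_apply (P Q A : Matrix n n ℂ) : sandwich P Q A = P * A * Q := rfl

lemma trace_sandwich (P Q : Matrix n n ℂ) :
    LinearMap.trace ℂ _ (sandwich P Q) = P.trace * Q.trace := by
  rw [LinearMap.trace_eq_matrix_trace ℂ (Matrix.stdBasis ℂ n n), Matrix.trace,
    Fintype.sum_prod_type]
  simp only [Matrix.diag_apply, LinearMap.toMatrix_apply, Matrix.stdBasis_eq_single,
    sandwich_apply, Matrix.trace, Finset.sum_mul_sum]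
  refine Finset.sum_congr rfl fun i _ => Finset.sum_congr rfl fun j _ => ?_
  change (P * (Matrix.single i j 1 : Matrix n n ℂ) * Q : Matrix n n ℂ) i j = _
  simp [Matrix.mul_apply, Matrix.single_apply, ite_and]

/-- The diagonal coefficient at the matrix unit `(i, j)` is `P i j * Q i j`. Transposition thus
turns a product of two traces into the trace of a product, which is the source of `χ (τ g * g)`. -/
lemma trace_sandwich_transpose (P Q : Matrix n n ℂ) :
    LinearMap.trace ℂ _ (sandwich P Q ∘ₗ (Matrix.transposeLinearEquiv n n ℂ ℂ).toLinearMap) =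
      (P * Qᵀ).trace := by
  rw [LinearMap.trace_eq_matrix_trace ℂ (Matrix.stdBasis ℂ n n), Matrix.trace,
    Fintype.sum_prod_type]
  simp only [Matrix.diag_apply, LinearMap.toMatrix_apply, Matrix.stdBasis_eq_single,
    LinearMap.comp_apply, Matrix.trace, Matrix.mul_apply, Matrix.transpose_apply]
  refine Finset.sum_congr rfl fun i _ => Finset.sum_congr rfl fun j _ => ?_
  change (P * (Matrix.single i j 1 : Matrix n n ℂ)ᵀ * Q : Matrix n n ℂ) i j = _
  simp [Matrix.mul_apply, Matrix.single_apply, Matrix.transpose_single, ite_and]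

variable {G : Type} [Group G]

/-- The representation on bilinear forms (given by their matrices) whose invariants satisfy
`B (R (τ g) u) (R g v) = B u v`. -/
def twistedFormRep (R : G →* Matrix n n ℂ) (τ : G →* G) : Representation ℂ G (Matrix n n ℂ) where
  toFun g := sandwich (R (τ g⁻¹))ᵀ (R g⁻¹)
  map_one' := by ext1; simp [sandwich_apply]
  map_mul' g h := by
    refine LinearMap.ext fun A => ?_
    simp [sandwich_apply, Matrix.mul_assoc]

lemma twistedFormRep_apply (R : G →* Matrix n n ℂ) (τ : G →* G) (g : G) (A : Matrix n n ℂ) :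
    twistedFormRep R τ g A = (R (τ g⁻¹))ᵀ * A * R g⁻¹ := rfl

lemma twistedFormRep_transpose (R : G →* Matrix n n ℂ) {τ : G →* G} (hτ : ∀ g, τ (τ g) = g)
    (g : G) (A : Matrix n n ℂ) :
    (twistedFormRep R τ g A)ᵀ = twistedFormRep R τ (τ g) Aᵀ := by
  simp only [twistedFormRep_apply, Matrix.transpose_mul, Matrix.transpose_transpose, map_inv, hτ,
    Matrix.mul_assoc]

variable [Fintype G]

/-- If the twisted invariant forms are spanned by one form, the twisted Frobenius–Schur indicator
squares to one. -/
theorem indicator_sq_of_finrank_invariants (R : G →* Matrix n n ℂ) {τ : G →* G}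
    (hτ : ∀ g, τ (τ g) = g)
    (h1 : Module.finrank ℂ (twistedFormRep R τ).invariants = 1) :
    ((Nat.card G : ℂ)⁻¹ * ∑ g : G, (R (τ g * g)).trace) ^ 2 = 1 := by
  have hcard : (Nat.card G : ℂ) ≠ 0 := Nat.cast_ne_zero.2 Nat.card_pos.ne'
  have : Invertible (Nat.card G : ℂ) := invertibleOfNonzero hcard
  have : Invertible (Fintype.card G : ℂ) := by rw [Fintype.card_eq_nat_card]; assumption
  set L := twistedFormRep R τ with hL
  set F : Matrix n n ℂ →ₗ[ℂ] Matrix n n ℂ := (Matrix.transposeLinearEquiv n n ℂ ℂ).toLinearMap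
  have hF : ∀ A, F A = Aᵀ := fun A => rfl
  have hP := L.isProj_averageMap
  have hPdef : L.averageMap = (Nat.card G : ℂ)⁻¹ • ∑ g : G, L g := by
    simp [Representation.averageMap, GroupAlgebra.average, map_sum]
  have htrP : LinearMap.trace ℂ _ L.averageMap = 1 := by rw [hP.trace, h1]; norm_num
  obtain ⟨B, hB0, hB⟩ := finrank_eq_one_iff'.1 h1
  have hmem : ∀ A, A ∈ L.invariants → Aᵀ ∈ L.invariants := by
    intro A hA g
    have := hA (τ g)
    rw [← hτ g, ← twistedFormRep_transpose R hτ, ← hL, this]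
  obtain ⟨ε, hε⟩ := hB ⟨(B : Matrix n n ℂ)ᵀ, hmem _ B.2⟩
  have hε' : ((B : Matrix n n ℂ))ᵀ = ε • (B : Matrix n n ℂ) := (congrArg Subtype.val hε).symm
  have hB0' : (B : Matrix n n ℂ) ≠ 0 := fun h => hB0 (Subtype.ext h)
  have hε2 : ε ^ 2 = 1 := by
    have h2 := congrArg Matrix.transpose hε'
    rw [Matrix.transpose_transpose, Matrix.transpose_smul, hε', smul_smul] at h2
    have h3 : (1 - ε * ε) • (B : Matrix n n ℂ) = 0 := by rw [sub_smul, one_smul, ← h2, sub_self]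
    rcases smul_eq_zero.1 h3 with h4 | h4
    · linear_combination -h4
    · exact absurd h4 hB0'
  -- The averaging projector has image the line of `B`, where transposition is `ε`. The two maps
  -- commute, because transposition exchanges the actions of `g` and `τ g`. So `ε` is the trace of
  -- the composite.
  have hPF : L.averageMap ∘ₗ F = ε • L.averageMap := by
    have hFP : F ∘ₗ L.averageMap = ε • L.averageMap := by
      refine LinearMap.ext fun A => ?_
      obtain ⟨c, hc⟩ := hB ⟨L.averageMap A, hP.map_mem A⟩
      have hc' : L.averageMap A = c • (B : Matrix n n ℂ) := (congrArg Subtype.val hc).symm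
      rw [LinearMap.comp_apply, LinearMap.smul_apply, hc', map_smul, hF, hε', smul_comm]
    rw [← hFP, hPdef]
    refine LinearMap.ext fun A => ?_
    simp only [LinearMap.comp_apply, LinearMap.smul_apply, LinearMap.sum_apply]
    rw [map_smul, map_sum]
    congr 1
    let e : G ≃ G := ⟨τ, τ, hτ, hτ⟩
    rw [← Equiv.sum_comp e]
    exact Finset.sum_congr rfl fun g _ => (twistedFormRep_transpose R hτ g A).symm
  have htr : LinearMap.trace ℂ _ (L.averageMap ∘ₗ F) = ε := by
    rw [hPF, map_smul, htrP, smul_eq_mul, mul_one]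
  rw [← hε2, ← htr, hPdef]
  congr 1
  have hsum : (∑ g : G, L g) ∘ₗ F = ∑ g : G, L g ∘ₗ F :=
    LinearMap.ext fun A => by simp [LinearMap.sum_apply]
  rw [LinearMap.smul_comp, map_smul, smul_eq_mul, hsum, map_sum]
  congr 1
  rw [← Equiv.sum_comp (Equiv.inv G)]
  refine Finset.sum_congr rfl fun g _ => ?_
  rw [show L g = sandwich (R (τ g⁻¹))ᵀ (R g⁻¹) from rfl, trace_sandwich_transpose,
    ← Matrix.transpose_mul, Matrix.trace_transpose, Matrix.trace_mul_comm, ← map_mul]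
  rfl

/-- The twisted Frobenius–Schur indicator of a simple representation whose twist is isomorphic to
its dual squares to one. -/
theorem FDRep.indicator_sq_eq_one {τ : G →* G} (hτ : ∀ g, τ (τ g) = g) (V : FDRep ℂ G) [Simple V]
    (hV : ∀ g, V.character (τ g) = V.character g⁻¹) :
    ((Nat.card G : ℂ)⁻¹ * ∑ g : G, V.character (τ g * g)) ^ 2 = 1 := by
  have hcard : (Nat.card G : ℂ) ≠ 0 := Nat.cast_ne_zero.2 Nat.card_pos.ne'
  have : Invertible (Nat.card G : ℂ) := invertibleOfNonzero hcard
  let b := Module.finBasis ℂ V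
  let R : G →* Matrix (Fin (Module.finrank ℂ V)) (Fin (Module.finrank ℂ V)) ℂ :=
    (LinearMap.toMatrixAlgEquiv b : _ →* _).comp V.ρ
  have hR : ∀ g, (R g).trace = V.character g := fun g =>
    (LinearMap.trace_eq_matrix_trace ℂ b (V.ρ g)).symm
  have h := indicator_sq_of_finrank_invariants R hτ ?_
  · simpa only [hR] using h
  · have h1 := (twistedFormRep R τ).card_inv_mul_sum_char_eq_finrank
    have h2 := V.scalar_product_char_eq_finrank_equivariant V
    rw [finrank_endomorphism_simple_eq_one] at h2
    -- The dimension of the invariant forms becomes the norm of the character of `V`, which is one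
    -- by Schur's lemma.
    have h3 : ∀ g, (twistedFormRep R τ).character g = V.character g * V.character g⁻¹ := by
      intro g
      refine (trace_sandwich _ _).trans ?_
      rw [Matrix.trace_transpose, hR, hR, hV, inv_inv]
    rw [Finset.sum_congr rfl fun g _ => h3 g, h2] at h1
    exact_mod_cast h1.symm

/-- A representation whose character counts the solutions of `x * τ x = g` is a Gelfand model,
if `τ` twists the simple representations to their duals. -/
theorem FDRep.isGelfandModel_of_character {τ : G →* G} (hτ : ∀ g, τ (τ g) = g)
    (hV : ∀ (V : FDRep ℂ G) (g : G), V.character (τ g) = V.character g⁻¹) (M : FDRep ℂ G)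
    (hM : ∀ g, M.character g = (Nat.card {x : G // x * τ x = g} : ℂ)) : IsGelfandModel M := by
  refine FDRep.isGelfandModel_of_finrank_hom M fun V _ => ?_
  classical
  have hcard : (Nat.card G : ℂ) ≠ 0 := Nat.cast_ne_zero.2 Nat.card_pos.ne'
  have : Invertible (Nat.card G : ℂ) := invertibleOfNonzero hcard
  have h1 := FDRep.indicator_sq_eq_one hτ V (hV V)
  have h2 := V.scalar_product_char_eq_finrank_equivariant M
  -- Up to the order of the group, this identifies the multiplicity of `V` in `M` with the
  -- indicator.
  have h3 : ∑ g : G, M.character g * V.character g⁻¹ = ∑ g : G, V.character (τ g * g) := by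
    calc ∑ g : G, M.character g * V.character g⁻¹
        = ∑ g : G, ∑ x : G, if x * τ x = g then V.character g⁻¹ else 0 := by
          refine Finset.sum_congr rfl fun g _ => ?_
          rw [hM, Nat.card_eq_fintype_card, Fintype.card_subtype, ← Finset.sum_filter,
            Finset.sum_const, nsmul_eq_mul]
      _ = ∑ x : G, V.character (x * τ x)⁻¹ := by
          rw [Finset.sum_comm]
          refine Finset.sum_congr rfl fun x _ => ?_
          rw [Finset.sum_ite_eq]
          simp
      _ = ∑ x : G, V.character (τ x * x) := by
          rw [← Equiv.sum_comp (Equiv.inv G)]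
          refine Finset.sum_congr rfl fun x _ => ?_
          simp
  rw [h3] at h2
  rw [h2] at h1
  have h4 : Module.finrank ℂ (V ⟶ M) ^ 2 = 1 := by exact_mod_cast h1
  simpa using h4

end TwistedFrobeniusSchur

/-! ### Orthogonality for roots of unity. -/

section RootsOfUnity

variable {ℓ : ℕ}

lemma sum_rootOfUnity_pow [NeZero ℓ] (z : rootsOfUnity ℓ ℂ) :
    ∑ k : Fin ℓ, ((z : ℂˣ) : ℂ) ^ ((k : ℕ) + 1) = if z = 1 then (ℓ : ℂ) else 0 := by
  split_ifs with h
  · simp [h]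
  · have hz : ((z : ℂˣ) : ℂ) ≠ 1 := fun h' => h (Subtype.ext (Units.ext h'))
    have hzl : ((z : ℂˣ) : ℂ) ^ ℓ = 1 := by
      have := (mem_rootsOfUnity ℓ (z : ℂˣ)).1 z.2
      rw [← Units.val_pow_eq_pow_val, this, Units.val_one]
    simp only [pow_succ]
    rw [← Finset.sum_mul, Fin.sum_univ_eq_sum_range (fun k => ((z : ℂˣ) : ℂ) ^ k),
      geom_sum_eq hz, hzl]
    simp

lemma exists_rootOfUnity_pow_ne [NeZero ℓ] {k m : Fin ℓ} (h : k ≠ m) :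
    ∃ z : rootsOfUnity ℓ ℂ, ((z : ℂˣ) : ℂ) ^ ((k : ℕ) + 1) ≠ ((z : ℂˣ) : ℂ) ^ ((m : ℕ) + 1) := by
  have hζ := Complex.isPrimitiveRoot_exp ℓ (NeZero.ne ℓ)
  refine ⟨hζ.toRootsOfUnity, fun heq => h ?_⟩
  have hne : Complex.exp (2 * Real.pi * Complex.I / ℓ) ≠ 0 := Complex.exp_ne_zero _
  rw [hζ.val_toRootsOfUnity_coe, pow_succ, pow_succ] at heq
  exact Fin.ext (hζ.pow_inj k.2 m.2 (mul_right_cancel₀ hne heq))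

noncomputable instance [NeZero ℓ] : Fintype (rootsOfUnity ℓ ℂ) := Fintype.ofFinite _

lemma sum_rootOfUnity_pow_mul_inv_pow [NeZero ℓ] (k m : Fin ℓ) :
    ∑ z : rootsOfUnity ℓ ℂ, ((z : ℂˣ) : ℂ) ^ ((k : ℕ) + 1) *
      (((z⁻¹ : rootsOfUnity ℓ ℂ) : ℂˣ) : ℂ) ^ ((m : ℕ) + 1) = if k = m then (ℓ : ℂ) else 0 := by
  split_ifs with h
  · subst h
    simp only [← mul_pow, ← Units.val_mul, ← Subgroup.coe_mul, mul_inv_cancel]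
    simp only [OneMemClass.coe_one, Units.val_one, one_pow, Finset.sum_const, Finset.card_univ,
      ← Nat.card_eq_fintype_card, Complex.card_rootsOfUnity, nsmul_eq_mul, mul_one]
  · obtain ⟨ζ, hζ⟩ := exists_rootOfUnity_pow_ne h
    set S := ∑ z : rootsOfUnity ℓ ℂ, ((z : ℂˣ) : ℂ) ^ ((k : ℕ) + 1) *
      (((z⁻¹ : rootsOfUnity ℓ ℂ) : ℂˣ) : ℂ) ^ ((m : ℕ) + 1) with hS
    -- Translating the sum by a root `ζ` that separates the two exponents multiplies it by a scalar
    -- different from one.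
    have h1 : S = ((ζ : ℂˣ) : ℂ) ^ ((k : ℕ) + 1) *
        (((ζ⁻¹ : rootsOfUnity ℓ ℂ) : ℂˣ) : ℂ) ^ ((m : ℕ) + 1) * S := by
      conv_lhs => rw [hS, ← Equiv.sum_comp (Equiv.mulLeft ζ)]
      rw [hS, Finset.mul_sum]
      refine Finset.sum_congr rfl fun z _ => ?_
      simp only [Equiv.coe_mulLeft, mul_inv, Subgroup.coe_mul, Units.val_mul, mul_pow]
      ring
    have h2 : (((ζ⁻¹ : rootsOfUnity ℓ ℂ) : ℂˣ) : ℂ) ^ ((m : ℕ) + 1) *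
        ((ζ : ℂˣ) : ℂ) ^ ((m : ℕ) + 1) = 1 := by
      rw [← mul_pow, ← Units.val_mul, ← Subgroup.coe_mul, inv_mul_cancel]
      simp
    have h3 : (((ζ : ℂˣ) : ℂ) ^ ((k : ℕ) + 1) - ((ζ : ℂˣ) : ℂ) ^ ((m : ℕ) + 1)) * S = 0 := by
      linear_combination (-((ζ : ℂˣ) : ℂ) ^ ((m : ℕ) + 1)) * h1 -
        ((ζ : ℂˣ) : ℂ) ^ ((k : ℕ) + 1) * S * h2
    exact (mul_eq_zero.1 h3).resolve_left (sub_ne_zero.2 hζ)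

end RootsOfUnity

/-! ### Colorings as characters of the diagonal group. -/

section DiagWeight

variable {ℓ d : ℕ}

noncomputable instance : Fintype (Coloring ℓ d) := Fintype.ofFinite _

noncomputable instance : DecidableEq (Coloring ℓ d) := Classical.decEq _

/-- Colorings are functions. -/
def Coloring.equivFun : Coloring ℓ d ≃ (Fin d → Fin ℓ) :=
  ⟨Coloring.color, Coloring.mk, fun _ => rfl, fun _ => rfl⟩

lemma Coloring.sum_prod (F : Fin d → Fin ℓ → ℂ) :
    ∑ f : Coloring ℓ d, ∏ i, F i (f.color i) = ∏ i, ∑ k, F i k := by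
  rw [Fintype.prod_sum, ← Equiv.sum_comp Coloring.equivFun]
  rfl

lemma diagWeight_one (f : Coloring ℓ d) : diagWeight 1 f = 1 := by simp [diagWeight]

lemma diagWeight_mul (a b : Fin d → rootsOfUnity ℓ ℂ) (f : Coloring ℓ d) :
    diagWeight (a * b) f = diagWeight a f * diagWeight b f := by
  simp [diagWeight, mul_pow, Finset.prod_mul_distrib]

lemma diagWeight_inv_mul_self (a : Fin d → rootsOfUnity ℓ ℂ) (f : Coloring ℓ d) :
    diagWeight a⁻¹ f * diagWeight a f = 1 := by
  rw [← diagWeight_mul, inv_mul_cancel, diagWeight_one]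

lemma diagWeight_mulAutArrow (σ : Equiv.Perm (Fin d)) (a : Fin d → rootsOfUnity ℓ ℂ)
    (f : Coloring ℓ d) : diagWeight (mulAutArrow σ a) f = diagWeight a ⟨f.color ∘ σ⟩ := by
  unfold diagWeight
  rw [← Equiv.prod_comp σ]
  refine Finset.prod_congr rfl fun i _ => ?_
  change (((a (σ⁻¹ (σ i)) : ℂˣ) : ℂ)) ^ _ = _
  rw [show σ⁻¹ (σ i) = i from σ.symm_apply_apply i]
  rfl

lemma sum_diagWeight_coloring [NeZero ℓ] (a : Fin d → rootsOfUnity ℓ ℂ) :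
    ∑ f : Coloring ℓ d, diagWeight a f = if a = 1 then (ℓ : ℂ) ^ d else 0 := by
  unfold diagWeight
  rw [Coloring.sum_prod (fun i k => ((a i : ℂˣ) : ℂ) ^ ((k : ℕ) + 1))]
  simp only [sum_rootOfUnity_pow]
  split_ifs with h
  · simp [h]
  · obtain ⟨i, hi⟩ := Function.ne_iff.1 h
    exact Finset.prod_eq_zero (Finset.mem_univ i) (if_neg hi)

lemma sum_diagWeight_mul_inv [NeZero ℓ] (f g : Coloring ℓ d) :
    ∑ a : Fin d → rootsOfUnity ℓ ℂ, diagWeight a f * diagWeight a⁻¹ g =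
      if f = g then (ℓ : ℂ) ^ d else 0 := by
  unfold diagWeight
  simp only [← Finset.prod_mul_distrib, Pi.inv_apply]
  rw [← Fintype.prod_sum (fun i (z : rootsOfUnity ℓ ℂ) =>
    ((z : ℂˣ) : ℂ) ^ ((f.color i : ℕ) + 1) *
      (((z⁻¹ : rootsOfUnity ℓ ℂ) : ℂˣ) : ℂ) ^ ((g.color i : ℕ) + 1))]
  simp only [sum_rootOfUnity_pow_mul_inv_pow]
  split_ifs with h
  · simp [h]
  · obtain ⟨i, hi⟩ := Function.ne_iff.1 (fun h' => h (Coloring.ext h'))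
    exact Finset.prod_eq_zero (Finset.mem_univ i) (if_neg hi)

lemma exists_diagWeight_ne [NeZero ℓ] {f g : Coloring ℓ d} (h : f ≠ g) :
    ∃ a : Fin d → rootsOfUnity ℓ ℂ, diagWeight a f ≠ diagWeight a g := by
  obtain ⟨i, hi⟩ := Function.ne_iff.1 (fun h' => h (Coloring.ext h'))
  obtain ⟨z, hz⟩ := exists_rootOfUnity_pow_ne hi
  refine ⟨Pi.mulSingle i z, ?_⟩
  have e : ∀ f : Coloring ℓ d, diagWeight (Pi.mulSingle i z) f =
      ((z : ℂˣ) : ℂ) ^ ((f.color i : ℕ) + 1) := by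
    intro f
    unfold diagWeight
    rw [Finset.prod_eq_single i]
    · rw [Pi.mulSingle_eq_same]
    · intro j _ hj
      rw [Pi.mulSingle_eq_of_ne hj]; simp
    · simp
  rwa [e, e]

/-- The number of solutions of `b * x • b⁻¹ = a`. -/
lemma card_twisted_coboundary [NeZero ℓ] (x : Equiv.Perm (Fin d)) (a : Fin d → rootsOfUnity ℓ ℂ) :
    (Nat.card {b : Fin d → rootsOfUnity ℓ ℂ // b * mulAutArrow x b⁻¹ = a} : ℂ) =
      ∑ f : Coloring ℓ d, if f.color ∘ x = f.color then diagWeight a f else 0 := by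
  have hl : (ℓ : ℂ) ^ d ≠ 0 := pow_ne_zero _ (Nat.cast_ne_zero.2 (NeZero.ne ℓ))
  refine mul_left_cancel₀ hl ?_
  have h1 : ∀ b : Fin d → rootsOfUnity ℓ ℂ,
      (b * mulAutArrow x b⁻¹ = a) ↔ a * mulAutArrow x b * b⁻¹ = 1 := by
    intro b
    rw [map_inv, mul_inv_eq_one, mul_inv_eq_iff_eq_mul, eq_comm]
  calc (ℓ : ℂ) ^ d * (Nat.card {b : Fin d → rootsOfUnity ℓ ℂ // b * mulAutArrow x b⁻¹ = a} : ℂ)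
      = ∑ b : Fin d → rootsOfUnity ℓ ℂ,
          if a * mulAutArrow x b * b⁻¹ = 1 then (ℓ : ℂ) ^ d else 0 := by
        simp only [h1]
        rw [Nat.card_eq_fintype_card, Fintype.card_subtype, ← Finset.sum_filter, Finset.sum_const,
          nsmul_eq_mul, mul_comm]
    -- The equation is detected by summing over all characters. Summing over `b` then compares the
    -- characters `f ∘ x` and `f`, leaving the colorings fixed by `x`.
    _ = ∑ f : Coloring ℓ d, ∑ b : Fin d → rootsOfUnity ℓ ℂ,
          diagWeight (a * mulAutArrow x b * b⁻¹) f := by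
        rw [Finset.sum_comm]
        exact Finset.sum_congr rfl fun b _ => (sum_diagWeight_coloring _).symm
    _ = ∑ f : Coloring ℓ d, diagWeight a f * if f.color ∘ x = f.color then (ℓ : ℂ) ^ d else 0 := by
        refine Finset.sum_congr rfl fun f _ => ?_
        simp only [diagWeight_mul, diagWeight_mulAutArrow, mul_assoc]
        rw [← Finset.mul_sum, sum_diagWeight_mul_inv]
        simp only [Coloring.ext_iff]
    _ = _ := by
        rw [Finset.mul_sum]
        refine Finset.sum_congr rfl fun f _ => ?_
        split_ifs <;> ring

end DiagWeight

/-! ### Conjugating a permutation to its inverse. -/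

section Reversal

/-- Every permutation is conjugate to its inverse by a permutation preserving its cycles. -/
lemma exists_conj_eq_inv {α : Type*} [Finite α] (σ : Equiv.Perm α) :
    ∃ π : Equiv.Perm α, (∀ i, σ.SameCycle i (π i)) ∧ π * σ = σ⁻¹ * π := by
  choose k hk using fun i => sameCycle_cycleRep σ i
  have hrep : ∀ i j, σ.SameCycle i j → cycleRep σ i = cycleRep σ j :=
    fun i j h => (cycleRep_eq_iff σ i j).2 h
  -- This reflects each cycle about its representative; `hp` shows that any exponent reaching `i`
  -- may replace `k i`.
  let p : α → α := fun i => (σ ^ (-k i)) (cycleRep σ i)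
  have hp : ∀ i (m : ℤ), (σ ^ m) (cycleRep σ i) = i → (σ ^ (-m)) (cycleRep σ i) = p i := by
    intro i m hm
    have := hm.trans (hk i).symm
    rw [zpow_apply_eq_zpow_apply_iff] at this
    rw [zpow_apply_eq_zpow_apply_iff]
    rw [show -m - -k i = -(m - k i) by ring]
    exact this.neg_right
  have hsame : ∀ i, σ.SameCycle i (p i) := by
    intro i
    refine (sameCycle_cycleRep σ i).symm.trans ⟨-k i, rfl⟩
  have hpp : ∀ i, p (p i) = i := by
    intro i
    have hr := hrep _ _ (hsame i)
    rw [← hp (p i) (-k i) (by rw [← hr]), ← hr, neg_neg, hk]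
  have hps : ∀ i, p (σ i) = σ⁻¹ (p i) := by
    intro i
    have hr : cycleRep σ (σ i) = cycleRep σ i :=
      hrep _ _ (by simpa using Equiv.Perm.SameCycle.refl σ i)
    rw [← hp (σ i) (1 + k i) (by rw [hr, zpow_add, Equiv.Perm.mul_apply, hk, zpow_one]), hr,
      neg_add, zpow_add, Equiv.Perm.mul_apply, zpow_neg_one]
  refine ⟨(show Function.Involutive p from hpp).toPerm, hsame, ?_⟩
  ext i
  exact hps i

end Reversal

/-! ### The trace of a block matrix. -/

section PiTrace

lemma LinearMap.trace_pi {ι : Type*} [Fintype ι] [DecidableEq ι] {V : ι → Type*}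
    [∀ i, AddCommGroup (V i)] [∀ i, Module ℂ (V i)] [∀ i, Module.Finite ℂ (V i)]
    (T : (∀ i, V i) →ₗ[ℂ] (∀ i, V i)) :
    LinearMap.trace ℂ _ T =
      ∑ i, LinearMap.trace ℂ (V i) (LinearMap.proj i ∘ₗ T ∘ₗ LinearMap.single ℂ V i) := by
  have hT : T = ∑ i, (T ∘ₗ LinearMap.single ℂ V i) ∘ₗ LinearMap.proj i := by
    refine LinearMap.ext fun v => ?_
    simp only [LinearMap.sum_apply, LinearMap.comp_apply, LinearMap.coe_single,
      LinearMap.coe_proj, Function.eval]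
    rw [← map_sum, Finset.univ_sum_single]
  conv_lhs => rw [hT, map_sum]
  exact Finset.sum_congr rfl fun i _ => LinearMap.trace_comp_comm' _ _

end PiTrace

/-! ### Gelfand models and equivalences. -/

section Transfer

/-- Gelfand models are reflected by equivalences. -/
theorem IsGelfandModel.of_equivalence {C D : Type*} [Category* C] [Category* D] [Preadditive C]
    [Preadditive D] (F : C ⥤ D) [F.IsEquivalence] [F.Additive] {M : C}
    (h : IsGelfandModel (F.obj M)) : IsGelfandModel M := by
  obtain ⟨n, S, hsimple, hinj, hsurj, b, ⟨hb⟩, ⟨e⟩⟩ := h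
  have : F.asEquivalence.functor.Additive := inferInstanceAs F.Additive
  have : F.inv.Additive := F.asEquivalence.inverse_additive
  have hFinv : ∀ i, Nonempty (F.obj (F.inv.obj (S i)) ≅ S i) :=
    fun i => ⟨F.asEquivalence.counitIso.app (S i)⟩
  have hinvF : ∀ X, Nonempty (X ≅ F.inv.obj (F.obj X)) :=
    fun X => ⟨F.asEquivalence.unitIso.app X⟩
  refine ⟨n, fun i => F.inv.obj (S i), fun i => ?_, fun i j ⟨hij⟩ => ?_, fun X hX => ?_,
    F.inv.mapBicone b, ⟨isBilimitOfPreserves F.inv hb⟩, ?_⟩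
  · have := hsimple i
    exact simple_obj F.inv (S i)
  · exact hinj i j ⟨F.inv.preimageIso hij⟩
  · have : Simple (F.obj X) := simple_obj F X
    obtain ⟨i, ⟨f⟩⟩ := hsurj (F.obj X) this
    obtain ⟨g⟩ := hinvF X
    exact ⟨i, ⟨g ≪≫ F.inv.mapIso f⟩⟩
  · obtain ⟨g⟩ := hinvF M
    exact ⟨g ≪≫ F.inv.mapIso e⟩

end Transfer

/-! ### From modules to representations: a fully faithful functor. -/

section WreathFunctor

variable {ℓ d : ℕ}

/-- The component of a morphism of modules at a coloring. -/
noncomputable def ColoringModule.component {M N : ColoringModule ℓ d} (η : M ⟶ N)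
    (f : Coloring ℓ d) : M.value f →ₗ[ℂ] N.value f :=
  (η.hom.app (Free.of ℂ f)).hom.hom

lemma ColoringModule.component_act {M N : ColoringModule ℓ d} (η : M ⟶ N) {f g : Coloring ℓ d}
    (σ : f ⟶ g) (x : M.value f) :
    ColoringModule.component η g (M.act σ x) = N.act σ (ColoringModule.component η f x) := by
  have h := η.hom.naturality ((Free.embedding ℂ (Coloring ℓ d)).map σ)
  exact congrArg (fun φ : M.obj.obj (Free.of ℂ f) ⟶ N.obj.obj (Free.of ℂ g) => φ.hom.hom x) h

lemma ColoringModule.hom_ext {M N : ColoringModule ℓ d} {η θ : M ⟶ N}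
    (h : ∀ f, ColoringModule.component η f = ColoringModule.component θ f) : η = θ := by
  apply ObjectProperty.hom_ext
  ext f : 2
  exact FGModuleCat.hom_ext (h f)

/-- A morphism of modules from components compatible with the morphisms of colorings. -/
noncomputable def ColoringModule.mkHom {M N : ColoringModule ℓ d}
    (φ : ∀ f : Coloring ℓ d, M.value f →ₗ[ℂ] N.value f)
    (h : ∀ {f g : Coloring ℓ d} (σ : f ⟶ g) (x : M.value f),
      φ g (M.act σ x) = N.act σ (φ f x)) : M ⟶ N :=
  ObjectProperty.homMk
    { app := fun f => FGModuleCat.ofHom (φ f)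
      naturality := fun f g ψ => by
        have := M.property.1
        have := N.property.1
        have := M.property.2
        have := N.property.2
        -- Both sides are linear in `ψ`, so naturality need only be checked on morphisms of
        -- colorings.
        induction ψ using Finsupp.induction_linear with
        | zero =>
          change M.obj.map (0 : f ⟶ g) ≫ _ = _ ≫ N.obj.map (0 : f ⟶ g)
          simp
        | add ψ₁ ψ₂ h₁ h₂ =>
          change M.obj.map ((ψ₁ : f ⟶ g) + ψ₂) ≫ _ = _ ≫ N.obj.map ((ψ₁ : f ⟶ g) + ψ₂)
          rw [Functor.map_add, Functor.map_add, Preadditive.add_comp, Preadditive.comp_add]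
          exact congrArg₂ (· + ·) h₁ h₂
        | single σ c =>
          obtain ⟨τ, hτ⟩ : ∃ τ : f ⟶ g, τ = Finsupp.single σ 1 := ⟨_, rfl⟩
          have e : (Finsupp.single σ c : f ⟶ g) = c • τ := by
            rw [hτ]
            exact (Finsupp.smul_single_one σ c).symm
          rw [e, Functor.map_smul, Functor.map_smul, Linear.smul_comp, Linear.comp_smul]
          congr 1
          rw [hτ]
          apply FGModuleCat.hom_ext
          exact LinearMap.ext fun x => h (f := f.coloring) (g := g.coloring) σ x }

lemma wreathRep_apply (M : ColoringModule ℓ d) (s : GenSymm ℓ d) (v : ∀ f, M.value f)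
    (g : Coloring ℓ d) : wreathRep M s v g =
      diagWeight s.left g • M.act (Coloring.pullback s.right g) (v ⟨g.color ∘ s.right⟩) := rfl

/-- `wreathRep` is defined by reading coordinates; this is the covariant description on vectors
supported at one coloring. -/
lemma wreathRep_single (M : ColoringModule ℓ d) {f g : Coloring ℓ d} (σ : f ⟶ g)
    (a : Fin d → rootsOfUnity ℓ ℂ) (x : M.value f) :
    wreathRep M ⟨a, Coloring.toPerm σ⟩ (Pi.single f x) =
      Pi.single g (diagWeight a g • M.act σ x) := by
  obtain ⟨f⟩ := f
  obtain ⟨s, hs⟩ := σ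
  change g.color ∘ s = f at hs
  subst hs
  funext g'
  rw [wreathRep_apply]
  by_cases h : g' = g
  · subst h
    rw [Pi.single_eq_same]
    refine congrArg (fun y => diagWeight a g' • M.act (Coloring.pullback s g') y) ?_
    exact Pi.single_eq_same _ _
  · rw [Pi.single_eq_of_ne h]
    have h' : (⟨g'.color ∘ s⟩ : Coloring ℓ d) ≠ ⟨g.color ∘ s⟩ := by
      intro heq
      have := congrArg Coloring.color heq
      exact h (Coloring.ext (s.surjective.injective_comp_right this))
    have h2 : (Pi.single (M := M.value) ⟨g.color ∘ s⟩ x) ⟨g'.color ∘ s⟩ = 0 :=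
      Pi.single_eq_of_ne h' _
    change diagWeight a g' • M.act (Coloring.pullback s g')
      ((Pi.single (M := M.value) ⟨g.color ∘ s⟩ x) ⟨g'.color ∘ s⟩) = 0
    rw [h2, map_zero, smul_zero]

lemma wreathRep_diag (M : ColoringModule ℓ d) (a : Fin d → rootsOfUnity ℓ ℂ)
    (v : ∀ f, M.value f) (g : Coloring ℓ d) :
    wreathRep M ⟨a, 1⟩ v g = diagWeight a g • v g := by
  change diagWeight a g • M.act (𝟙 g) (v g) = _
  rw [M.act_id]
  rfl

/-- The functor from modules to representations of the generalized symmetric group. -/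
noncomputable def wreathFunctor (ℓ d : ℕ) : ColoringModule ℓ d ⥤ FDRep ℂ (GenSymm ℓ d) where
  obj M := wreathModule M
  map {M N} η :=
    { hom := FGModuleCat.ofHom
        (LinearMap.pi fun f => ColoringModule.component η f ∘ₗ LinearMap.proj f)
      comm := fun s => by
        apply FGModuleCat.hom_ext
        refine LinearMap.ext fun (v : ∀ f, M.value f) => funext fun g => ?_
        change ColoringModule.component η g (wreathRep M s v g) =
          wreathRep N s (fun f => ColoringModule.component η f (v f)) g
        rw [wreathRep_apply, wreathRep_apply, map_smul, ColoringModule.component_act] }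
  map_id M := rfl
  map_comp η θ := rfl

lemma wreathFunctor_map_apply {M N : ColoringModule ℓ d} (η : M ⟶ N) (v : ∀ f, M.value f)
    (f : Coloring ℓ d) :
    ((wreathFunctor ℓ d).map η).hom.hom.hom v f = ColoringModule.component η f (v f) := rfl

instance : (wreathFunctor ℓ d).Additive where
  map_add := rfl

instance : (wreathFunctor ℓ d).Faithful where
  map_injective {M N} η θ h := by
    refine ColoringModule.hom_ext fun f => LinearMap.ext fun x => ?_
    have := congrArg (fun φ => φ.hom.hom.hom (Pi.single (M := M.value) f x) f) h
    have h2 := (wreathFunctor_map_apply η (Pi.single f x) f).symm.trans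
      (this.trans (wreathFunctor_map_apply θ (Pi.single f x) f))
    rwa [Pi.single_eq_same] at h2

/-- The linear map underlying a morphism of representations. -/
noncomputable def wreathModule.toLinearMap {M N : ColoringModule ℓ d}
    (φ : wreathModule M ⟶ wreathModule N) : (∀ f, M.value f) →ₗ[ℂ] (∀ f, N.value f) :=
  φ.hom.hom.hom

lemma wreathModule.toLinearMap_wreathRep {M N : ColoringModule ℓ d}
    (φ : wreathModule M ⟶ wreathModule N) (s : GenSymm ℓ d) (v : ∀ f, M.value f) :
    toLinearMap φ (wreathRep M s v) = wreathRep N s (toLinearMap φ v) :=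
  congrArg (fun ψ : (wreathModule M).V ⟶ (wreathModule N).V => ψ.hom.hom v) (φ.comm s)

/-- An equivariant map commutes with the diagonal matrices, whose weights separate colorings, so it
cannot move the support. This yields the components needed for fullness. -/
lemma wreathModule.toLinearMap_single [NeZero ℓ] {M N : ColoringModule ℓ d}
    (φ : wreathModule M ⟶ wreathModule N) (f : Coloring ℓ d) (x : M.value f) :
    toLinearMap φ (Pi.single f x) = Pi.single f (toLinearMap φ (Pi.single f x) f) := by
  funext g
  by_cases h : g = f
  · subst h
    rw [Pi.single_eq_same]
  · rw [Pi.single_eq_of_ne h]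
    obtain ⟨a, ha⟩ := exists_diagWeight_ne h
    have h1 := toLinearMap_wreathRep φ ⟨a, 1⟩ (Pi.single f x)
    have h2 : wreathRep M ⟨a, 1⟩ (Pi.single f x) = diagWeight a f • Pi.single f x := by
      rw [show (⟨a, 1⟩ : GenSymm ℓ d) = ⟨a, Coloring.toPerm (𝟙 f)⟩ from rfl, wreathRep_single,
        M.act_id, Pi.single_smul]
      rfl
    rw [h2, map_smul] at h1
    have h3 := congrFun h1 g
    rw [wreathRep_diag] at h3
    have h4 : (diagWeight a g - diagWeight a f) • toLinearMap φ (Pi.single f x) g = 0 := by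
      rw [sub_smul, ← h3]
      exact sub_self _
    exact (smul_eq_zero.1 h4).resolve_left (sub_ne_zero.2 ha)

instance [NeZero ℓ] : (wreathFunctor ℓ d).Full where
  map_surjective {M N} φ := by
    set Φ := wreathModule.toLinearMap φ with hΦ
    have hsingle : ∀ f x, Φ (Pi.single f x) = Pi.single f (Φ (Pi.single f x) f) :=
      wreathModule.toLinearMap_single φ
    refine ⟨ColoringModule.mkHom
      (fun f => LinearMap.proj f ∘ₗ Φ ∘ₗ LinearMap.single ℂ M.value f) ?_, ?_⟩
    · intro f g σ x
      change Φ (Pi.single g (M.act σ x)) g = N.act σ (Φ (Pi.single f x) f)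
      have h1 := wreathModule.toLinearMap_wreathRep φ ⟨1, Coloring.toPerm σ⟩ (Pi.single f x)
      rw [← hΦ, hsingle f x, wreathRep_single, wreathRep_single, diagWeight_one, one_smul,
        one_smul] at h1
      rw [h1, Pi.single_eq_same]
    · apply Action.hom_ext
      apply FGModuleCat.hom_ext
      refine LinearMap.pi_ext (φ := M.value) fun f x => funext fun g => ?_
      refine (wreathFunctor_map_apply _ (Pi.single f x) g).trans ?_
      change Φ (Pi.single g ((Pi.single f x : ∀ f, M.value f) g)) g = Φ (Pi.single f x) g
      by_cases h : g = f
      · subst h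
        rw [Pi.single_eq_same]
      · rw [Pi.single_eq_of_ne h, Pi.single_zero, map_zero, hsingle f x, Pi.single_eq_of_ne h]
        rfl

end WreathFunctor

/-! ### Modules from actions of the groupoid. -/

section Extension

variable {ℓ d : ℕ}

namespace ColoringModule

/-- A system of finite dimensional vector spaces with an action of the groupoid of colorings. -/
structure Action (W : Coloring ℓ d → Type) [∀ f, AddCommGroup (W f)] [∀ f, Module ℂ (W f)] where
  map {f g : Coloring ℓ d} (σ : f ⟶ g) : W f →ₗ[ℂ] W g
  map_id (f : Coloring ℓ d) : map (𝟙 f) = LinearMap.id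
  map_comp {f g h : Coloring ℓ d} (τ : f ⟶ g) (σ : g ⟶ h) : map (τ ≫ σ) = map σ ∘ₗ map τ

variable {W : Coloring ℓ d → Type} [∀ f, AddCommGroup (W f)] [∀ f, Module ℂ (W f)]

/-- The linear extension of an action to linear combinations of morphisms. -/
noncomputable def Action.linearMap (A : Action W) {f g : Coloring ℓ d} :
    ((f ⟶ g) →₀ ℂ) →ₗ[ℂ] W f →ₗ[ℂ] W g :=
  Finsupp.linearCombination ℂ A.map

lemma Action.linearMap_single (A : Action W) {f g : Coloring ℓ d} (σ : f ⟶ g) (c : ℂ) :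
    A.linearMap (Finsupp.single σ c) = c • A.map σ := by
  simp [Action.linearMap]

lemma Action.linearMap_comp (A : Action W) {f g h : Coloring ℓ d} (φ : (f ⟶ g) →₀ ℂ)
    (ψ : (g ⟶ h) →₀ ℂ) :
    A.linearMap (φ.sum fun τ s => ψ.sum fun σ t => Finsupp.single (τ ≫ σ) (s * t)) =
      A.linearMap ψ ∘ₗ A.linearMap φ := by
  have e : ∀ {a b : Coloring ℓ d} (χ : (a ⟶ b) →₀ ℂ),
      A.linearMap χ = ∑ σ ∈ χ.support, χ σ • A.map σ := fun χ => rfl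
  rw [e φ, e ψ]
  refine LinearMap.ext fun v => ?_
  simp only [Finsupp.sum, map_sum, Action.linearMap_single, A.map_comp, LinearMap.sum_apply,
    LinearMap.comp_apply, LinearMap.smul_apply, map_smul, Finset.smul_sum, smul_smul]

variable [∀ f, Module.Finite ℂ (W f)]

/-- The module given by an action. -/
noncomputable def ofAction (A : Action W) : ColoringModule ℓ d :=
  ⟨{ obj f := FGModuleCat.of ℂ (W f.coloring)
     map {f g} φ := FGModuleCat.ofHom (A.linearMap (f := f.coloring) (g := g.coloring) φ)
     map_id f := by
      apply FGModuleCat.hom_ext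
      refine (A.linearMap_single (𝟙 f.coloring) 1).trans ?_
      rw [one_smul, A.map_id]
      rfl
     map_comp {f g h} φ ψ := by
      apply FGModuleCat.hom_ext
      exact A.linearMap_comp (f := f.coloring) (g := g.coloring) (h := h.coloring) φ ψ },
    { map_add := fun {_ _ φ ψ} => FGModuleCat.hom_ext (map_add A.linearMap φ ψ) },
    { map_smul := fun {f g} φ c => FGModuleCat.hom_ext
        (map_smul (A.linearMap (f := f.coloring) (g := g.coloring)) c φ) }⟩

lemma ofAction_act (A : Action W) {f g : Coloring ℓ d} (σ : f ⟶ g) :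
    (ofAction A).act σ = A.map σ :=
  (A.linearMap_single σ 1).trans (one_smul _ _)

end ColoringModule

end Extension

/-! ### Weight spaces and essential surjectivity. -/

section WeightSpaces

variable {ℓ d : ℕ}

/-- The subspace on which the diagonal matrices act by the weight given by a coloring. -/
def weightSpace (V : FDRep ℂ (GenSymm ℓ d)) (f : Coloring ℓ d) : Submodule ℂ V where
  carrier := {v | ∀ a, V.ρ ⟨a, 1⟩ v = diagWeight a f • v}
  add_mem' hv hw a := by rw [map_add, hv a, hw a, smul_add]
  zero_mem' a := by rw [map_zero, smul_zero]
  smul_mem' c v hv a := by rw [map_smul, hv a, smul_comm]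

lemma rho_perm_mul_diag (V : FDRep ℂ (GenSymm ℓ d)) (σ : Equiv.Perm (Fin d))
    (b : Fin d → rootsOfUnity ℓ ℂ) (v : V) :
    V.ρ ⟨mulAutArrow σ b, 1⟩ (V.ρ ⟨1, σ⟩ v) = V.ρ ⟨1, σ⟩ (V.ρ ⟨b, 1⟩ v) := by
  rw [← Module.End.mul_apply, ← Module.End.mul_apply, ← map_mul, ← map_mul]
  congr 2
  ext1 <;> simp

lemma rho_perm_mem_weightSpace (V : FDRep ℂ (GenSymm ℓ d)) {f g : Coloring ℓ d} (σ : f ⟶ g)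
    {v : V} (hv : v ∈ weightSpace V f) :
    V.ρ ⟨1, Coloring.toPerm σ⟩ v ∈ weightSpace V g := by
  intro a
  obtain ⟨b, rfl⟩ := (mulAutArrow (Coloring.toPerm σ)).surjective a
  have hf : (⟨g.color ∘ Coloring.toPerm σ⟩ : Coloring ℓ d) = f := Coloring.ext σ.2
  rw [rho_perm_mul_diag, hv b, map_smul, diagWeight_mulAutArrow, hf]

/-- The action of the groupoid of colorings on the weight spaces. -/
noncomputable def weightAction (V : FDRep ℂ (GenSymm ℓ d)) :
    ColoringModule.Action (fun f : Coloring ℓ d => weightSpace V f) where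
  map {f g} σ := (V.ρ ⟨1, Coloring.toPerm σ⟩).restrict fun _ => rho_perm_mem_weightSpace V σ
  map_id f := by
    refine LinearMap.ext fun v => Subtype.ext ?_
    change V.ρ 1 v = v
    rw [map_one]
    rfl
  map_comp {f g h} τ σ := by
    refine LinearMap.ext fun v => Subtype.ext ?_
    change V.ρ ⟨1, Coloring.toPerm σ * Coloring.toPerm τ⟩ v =
      V.ρ ⟨1, Coloring.toPerm σ⟩ (V.ρ ⟨1, Coloring.toPerm τ⟩ v)
    rw [← Module.End.mul_apply, ← map_mul]
    congr 2
    ext1 <;> simp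

/-- The module of weight spaces of a representation. -/
noncomputable def weightModule (V : FDRep ℂ (GenSymm ℓ d)) : ColoringModule ℓ d :=
  ColoringModule.ofAction (weightAction V)

variable [NeZero ℓ]

/-- The projection to a weight space. -/
noncomputable def weightProj (V : FDRep ℂ (GenSymm ℓ d)) (f : Coloring ℓ d) :
    V →ₗ[ℂ] weightSpace V f :=
  LinearMap.codRestrict _
    (((ℓ : ℂ) ^ d)⁻¹ • ∑ a : Fin d → rootsOfUnity ℓ ℂ, diagWeight a⁻¹ f • V.ρ ⟨a, 1⟩) (by
      intro v b
      simp only [LinearMap.smul_apply, LinearMap.sum_apply, map_smul, map_sum]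
      rw [smul_comm (diagWeight b f)]
      congr 1
      -- Translating the average by `b` produces exactly the weight of `b` at `f`.
      conv_rhs => rw [← Equiv.sum_comp (Equiv.mulLeft b), Finset.smul_sum]
      refine Finset.sum_congr rfl fun a _ => ?_
      have h1 : (⟨b * a, 1⟩ : GenSymm ℓ d) = ⟨b, 1⟩ * ⟨a, 1⟩ := by ext1 <;> simp
      rw [Equiv.coe_mulLeft, h1, map_mul, Module.End.mul_apply, smul_smul, mul_inv, diagWeight_mul,
        ← mul_assoc, mul_comm (diagWeight b f), diagWeight_inv_mul_self, one_mul])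

lemma coe_weightProj (V : FDRep ℂ (GenSymm ℓ d)) (f : Coloring ℓ d) (v : V) :
    (weightProj V f v : V) =
      ((ℓ : ℂ) ^ d)⁻¹ • ∑ a : Fin d → rootsOfUnity ℓ ℂ, diagWeight a⁻¹ f • V.ρ ⟨a, 1⟩ v := by
  simp [weightProj]

lemma sum_weightProj (V : FDRep ℂ (GenSymm ℓ d)) (v : V) :
    ∑ f, (weightProj V f v : V) = v := by
  have hl : (ℓ : ℂ) ^ d ≠ 0 := pow_ne_zero _ (Nat.cast_ne_zero.2 (NeZero.ne ℓ))
  simp only [coe_weightProj]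
  rw [← Finset.smul_sum, Finset.sum_comm]
  simp only [← Finset.sum_smul, sum_diagWeight_coloring, inv_eq_one, ite_smul, zero_smul]
  rw [Finset.sum_ite_eq' Finset.univ, if_pos (Finset.mem_univ _), smul_smul, inv_mul_cancel₀ hl,
    one_smul]
  change V.ρ 1 v = v
  rw [map_one]
  rfl

lemma weightProj_of_mem (V : FDRep ℂ (GenSymm ℓ d)) (f g : Coloring ℓ d) (v : weightSpace V f) :
    (weightProj V g v : V) = if f = g then (v : V) else 0 := by
  have hl : (ℓ : ℂ) ^ d ≠ 0 := pow_ne_zero _ (Nat.cast_ne_zero.2 (NeZero.ne ℓ))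
  rw [coe_weightProj]
  have h1 : ∀ a, diagWeight a⁻¹ g • V.ρ ⟨a, 1⟩ (v : V) =
      (diagWeight a f * diagWeight a⁻¹ g) • (v : V) := fun a => by
    rw [v.2 a, smul_smul, mul_comm]
  rw [Finset.sum_congr rfl fun a _ => h1 a, ← Finset.sum_smul, sum_diagWeight_mul_inv]
  split_ifs
  · rw [smul_smul, inv_mul_cancel₀ hl, one_smul]
  · rw [zero_smul, smul_zero]

/-- A representation is the direct sum of its weight spaces. -/
noncomputable def weightEquiv (V : FDRep ℂ (GenSymm ℓ d)) :
    (∀ f : Coloring ℓ d, weightSpace V f) ≃ₗ[ℂ] V where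
  toFun v := ∑ f, (v f : V)
  map_add' v w := by simp [Finset.sum_add_distrib]
  map_smul' c v := by simp [Finset.smul_sum]
  invFun v f := weightProj V f v
  left_inv v := by
    funext g
    apply Subtype.ext
    change (weightProj V g (∑ f, (v f : V)) : V) = v g
    rw [map_sum, AddSubmonoidClass.coe_finsetSum]
    simp only [weightProj_of_mem]
    simp
  right_inv v := sum_weightProj V v

lemma weightEquiv_wreathRep (V : FDRep ℂ (GenSymm ℓ d)) (s : GenSymm ℓ d)
    (v : ∀ f, (weightModule V).value f) :
    weightEquiv V (wreathRep (weightModule V) s v) = V.ρ s (weightEquiv V v) := by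
  obtain ⟨a, σ⟩ := s
  change ∑ g, (weightSpace V g).subtype (wreathRep (weightModule V) ⟨a, σ⟩ v g) =
    V.ρ ⟨a, σ⟩ (∑ f, (weightSpace V f).subtype (v f))
  let e : Coloring ℓ d ≃ Coloring ℓ d :=
    ⟨fun g => ⟨g.color ∘ σ⟩, fun g => ⟨g.color ∘ σ.symm⟩,
      fun g => Coloring.ext (funext fun i => congrArg g.color (σ.apply_symm_apply i)),
      fun g => Coloring.ext (funext fun i => congrArg g.color (σ.symm_apply_apply i))⟩
  rw [map_sum]
  conv_rhs => rw [← Equiv.sum_comp e]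
  refine Finset.sum_congr rfl fun g _ => ?_
  have hact : (weightSpace V g).subtype ((weightModule V).act (Coloring.pullback σ g) (v (e g))) =
      V.ρ ⟨1, σ⟩ ((weightSpace V (e g)).subtype (v (e g))) := by
    have := ColoringModule.ofAction_act (weightAction V) (Coloring.pullback σ g)
    exact congrArg (fun F => (weightSpace V g).subtype (F (v (e g)))) this
  rw [wreathRep_apply]
  refine (map_smul (weightSpace V g).subtype _ _).trans ?_
  refine (congrArg (fun y => diagWeight a g • y) hact).trans ?_
  have h1 : (⟨a, σ⟩ : GenSymm ℓ d) = ⟨a, 1⟩ * ⟨1, σ⟩ := by ext1 <;> simp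
  rw [h1, map_mul, Module.End.mul_apply]
  exact (rho_perm_mem_weightSpace V (Coloring.pullback σ g) (v (e g)).2 a).symm

/-- A representation is recovered from its weight spaces. -/
noncomputable def wreathModuleWeightIso (V : FDRep ℂ (GenSymm ℓ d)) :
    wreathModule (weightModule V) ≅ V :=
  Action.mkIso (LinearEquiv.toFGModuleCatIso (weightEquiv V)) fun s => by
    apply FGModuleCat.hom_ext
    exact LinearMap.ext fun v => weightEquiv_wreathRep V s v

instance : (wreathFunctor ℓ d).EssSurj where
  mem_essImage V := ⟨weightModule V, ⟨wreathModuleWeightIso V⟩⟩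

instance : (wreathFunctor ℓ d).IsEquivalence where

end WeightSpaces

/-! ### Comparison of characters and conclusion. -/

section Characters

variable {ℓ d : ℕ}

open Classical in
/-- The trace of `σ` on the value of a module at `f`, if `σ` preserves `f`. -/
noncomputable def ColoringModule.selfTrace (M : ColoringModule ℓ d) (f : Coloring ℓ d)
    (σ : Equiv.Perm (Fin d)) : ℂ :=
  if h : f.color ∘ σ = f.color then LinearMap.trace ℂ (M.value f) (M.act (⟨σ, h⟩ : f ⟶ f)) else 0

/-- The permutation conjugating `σ` to its inverse preserves the cycles of `σ`. As `f` is constant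
on these cycles, the conjugation takes place in the automorphism group of `f`. -/
lemma ColoringModule.selfTrace_inv (M : ColoringModule ℓ d) (f : Coloring ℓ d)
    (σ : Equiv.Perm (Fin d)) : M.selfTrace f σ⁻¹ = M.selfTrace f σ := by
  unfold ColoringModule.selfTrace
  by_cases h : f.color ∘ σ = f.color
  · have h' : f.color ∘ (σ⁻¹ : Equiv.Perm (Fin d)) = f.color := by
      funext i
      exact comp_zpow_apply h (-1) i
    rw [dif_pos h, dif_pos h']
    obtain ⟨π, hπ, hc⟩ := exists_conj_eq_inv σ
    have hπf : f.color ∘ π = f.color := by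
      funext i
      obtain ⟨k, hk⟩ := hπ i
      rw [Function.comp_apply, ← hk, comp_zpow_apply h]
    let p : f ⟶ f := ⟨π, hπf⟩
    let s : f ⟶ f := ⟨σ, h⟩
    let t : f ⟶ f := ⟨σ⁻¹, h'⟩
    have hst : s ≫ p = p ≫ t := Coloring.hom_ext hc
    have ht : t = (Groupoid.inv p ≫ s) ≫ p := by
      rw [Category.assoc, hst, ← Category.assoc, Groupoid.inv_comp, Category.id_comp]
    change LinearMap.trace ℂ (M.value f) (M.act t) = LinearMap.trace ℂ (M.value f) (M.act s)
    rw [ht, M.act_comp, LinearMap.trace_comp_comm', ← M.act_comp,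
      ← Category.assoc, Groupoid.comp_inv, Category.id_comp]
  · have h' : ¬ f.color ∘ (σ⁻¹ : Equiv.Perm (Fin d)) = f.color := fun h' => h (by
      funext i
      simpa using comp_zpow_apply h' (-1) i)
    rw [dif_neg h, dif_neg h']

/-- Only blocks with `f ∘ σ = f` lie on the diagonal. -/
lemma wreathModule_character (M : ColoringModule ℓ d) (a : Fin d → rootsOfUnity ℓ ℂ)
    (σ : Equiv.Perm (Fin d)) :
    (wreathModule M).character ⟨a, σ⟩ = ∑ f, diagWeight a f * M.selfTrace f σ := by
  change LinearMap.trace ℂ (∀ f, M.value f) (wreathRep M ⟨a, σ⟩) = _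
  rw [LinearMap.trace_pi]
  refine Finset.sum_congr rfl fun f _ => ?_
  unfold ColoringModule.selfTrace
  split_ifs with h
  · rw [← smul_eq_mul, ← map_smul]
    congr 1
    refine LinearMap.ext fun x => ?_
    have h1 := wreathRep_single M (⟨σ, h⟩ : f ⟶ f) a x
    change wreathRep M ⟨a, σ⟩ (Pi.single f x) f = _
    exact (congrFun h1 f).trans (Pi.single_eq_same _ _)
  · rw [mul_zero]
    convert! map_zero (LinearMap.trace ℂ (M.value f))
    refine LinearMap.ext fun x => ?_
    change wreathRep M ⟨a, σ⟩ (Pi.single f x) f = 0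
    have h2 : (Pi.single f x : ∀ f, M.value f) ⟨f.color ∘ σ⟩ = 0 :=
      Pi.single_eq_of_ne (fun heq => h (congrArg Coloring.color heq)) _
    rw [wreathRep_apply]
    change diagWeight a f • M.act (Coloring.pullback σ f)
      ((Pi.single f x : ∀ f, M.value f) ⟨f.color ∘ σ⟩) = 0
    rw [h2, map_zero, smul_zero]

/-- The automorphism of the generalized symmetric group which inverts the diagonal matrices. -/
def diagInvHom (ℓ d : ℕ) : GenSymm ℓ d →* GenSymm ℓ d where
  toFun s := ⟨s.left⁻¹, s.right⟩
  map_one' := by ext1 <;> simp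
  map_mul' s t := by ext1 <;> simp [mul_comm]

lemma diagInvHom_apply (s : GenSymm ℓ d) : diagInvHom ℓ d s = ⟨s.left⁻¹, s.right⟩ := rfl

/-- Replace `V` by the module of its weight spaces. Where `f ∘ σ = f`, the diagonal part of the
inverse has the weight of `a⁻¹`, and the trace of `σ` does not change under inversion. -/
lemma character_diagInvHom [NeZero ℓ] (V : FDRep ℂ (GenSymm ℓ d)) (s : GenSymm ℓ d) :
    V.character (diagInvHom ℓ d s) = V.character s⁻¹ := by
  obtain ⟨a, σ⟩ := s
  have h1 : (⟨a, σ⟩ : GenSymm ℓ d)⁻¹ = ⟨mulAutArrow σ⁻¹ a⁻¹, σ⁻¹⟩ := by ext1 <;> simp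
  rw [← FDRep.char_iso (wreathModuleWeightIso V), diagInvHom_apply, h1, wreathModule_character,
    wreathModule_character]
  refine Finset.sum_congr rfl fun f _ => ?_
  rw [ColoringModule.selfTrace_inv]
  by_cases h : f.color ∘ σ = f.color
  · rw [diagWeight_mulAutArrow]
    have h' : (⟨f.color ∘ (σ⁻¹ : Equiv.Perm (Fin d))⟩ : Coloring ℓ d) = f :=
      Coloring.ext (by
        funext i
        change f.color (σ⁻¹ i) = f.color i
        simpa using comp_zpow_apply h (-1) i)
    rw [h']
  · rw [ColoringModule.selfTrace, dif_neg h, mul_zero, mul_zero]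

lemma gelfandModule_act {f g : Coloring ℓ d} (σ : f ⟶ g) :
    (gelfandModule ℓ d).act σ = gelfandAction σ :=
  (gelfandMap_single σ 1).trans (one_smul _ _)

lemma trace_gelfandAction (f : Coloring ℓ d) (σ : f ⟶ f) :
    LinearMap.trace ℂ _ (gelfandAction σ) = (squareRoots f.color (Coloring.toPerm σ)).card := by
  classical
  have : Fintype f.Involution := Fintype.ofFinite _
  rw [← sum_neg_one_pow_inversions (σ := Coloring.toPerm σ) σ.2,
    LinearMap.trace_eq_matrix_trace ℂ (Finsupp.basisSingleOne (ι := f.Involution)), Matrix.trace]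
  have h1 : ∀ w : f.Involution,
      (LinearMap.toMatrix Finsupp.basisSingleOne Finsupp.basisSingleOne (gelfandAction σ)).diag w =
        if w.conj σ = w then
          (-1 : ℂ) ^ inversions (Coloring.toPerm σ) (Coloring.toPerm w.hom) else 0 := by
    intro w
    rw [Matrix.diag_apply, LinearMap.toMatrix_apply, Finsupp.coe_basisSingleOne,
      gelfandAction_single]
    simp [Finsupp.single_apply]
  rw [Finset.sum_congr rfl fun w _ => h1 w, ← Finset.sum_filter]
  refine Finset.sum_bij (fun w _ => Coloring.toPerm w.hom) ?_ ?_ ?_ ?_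
  · intro w hw
    have hw := congrArg (fun w => Coloring.toPerm (Coloring.Involution.hom w))
      (Finset.mem_filter.1 hw).2
    change Coloring.toPerm σ * Coloring.toPerm w.hom * (Coloring.toPerm σ)⁻¹ =
      Coloring.toPerm w.hom at hw
    refine mem_commutingInvolutions.2 ⟨fun i => ?_, mul_inv_eq_iff_eq_mul.1 hw, w.hom.2⟩
    exact Equiv.congr_fun (congrArg Coloring.toPerm w.hom_comp_hom) i
  · intro w _ w' _ h
    exact Coloring.Involution.ext (Coloring.hom_ext h)
  · intro w hw
    obtain ⟨h1, h2, h3⟩ := mem_commutingInvolutions.1 hw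
    refine ⟨⟨⟨w, h3⟩, Coloring.hom_ext (Equiv.ext h1)⟩, ?_, rfl⟩
    refine Finset.mem_filter.2 ⟨Finset.mem_univ _,
      Coloring.Involution.ext (Coloring.hom_ext ?_)⟩
    change Coloring.toPerm σ * w * (Coloring.toPerm σ)⁻¹ = w
    exact mul_inv_eq_iff_eq_mul.2 h2
  · intro w _
    rfl

lemma selfTrace_gelfandModule (f : Coloring ℓ d) (σ : Equiv.Perm (Fin d)) :
    (gelfandModule ℓ d).selfTrace f σ = (squareRoots f.color σ).card := by
  unfold ColoringModule.selfTrace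
  split_ifs with h
  · rw [gelfandModule_act]
    exact trace_gelfandAction f ⟨σ, h⟩
  · symm
    rw [Nat.cast_eq_zero, Finset.card_eq_zero, Finset.eq_empty_iff_forall_notMem]
    intro x hx
    obtain ⟨h1, h2⟩ := mem_squareRoots.1 hx
    refine h (funext fun i => ?_)
    have h3 : ∀ i, f.color (x i) = f.color i := fun i => congrFun h2 i
    rw [Function.comp_apply, ← h1, h3, h3]

lemma card_twisted_square_roots [NeZero ℓ] (a : Fin d → rootsOfUnity ℓ ℂ)
    (σ : Equiv.Perm (Fin d)) :
    (Nat.card {x : GenSymm ℓ d // x * diagInvHom ℓ d x = ⟨a, σ⟩} : ℂ) =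
      ∑ f : Coloring ℓ d, diagWeight a f * (squareRoots f.color σ).card := by
  classical
  -- For `x = (b, π)` the product is `(b * π(b⁻¹), π * π)`, so the equation splits into a square
  -- root of `σ` and a twisted coboundary equation for `b`.
  let e : {x : GenSymm ℓ d // x * diagInvHom ℓ d x = ⟨a, σ⟩} ≃
      Σ x : {x : Equiv.Perm (Fin d) // x * x = σ},
        {b : Fin d → rootsOfUnity ℓ ℂ // b * mulAutArrow x.1 b⁻¹ = a} :=
    { toFun x := ⟨⟨x.1.right, congrArg SemidirectProduct.right x.2⟩,
        ⟨x.1.left, congrArg SemidirectProduct.left x.2⟩⟩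
      invFun y := ⟨⟨y.2.1, y.1.1⟩, SemidirectProduct.ext y.2.2 y.1.2⟩
      left_inv x := rfl
      right_inv y := rfl }
  rw [Nat.card_congr e, Nat.card_sigma, Nat.cast_sum]
  simp only [card_twisted_coboundary]
  rw [Finset.sum_comm]
  refine Finset.sum_congr rfl fun f _ => ?_
  rw [← Finset.sum_subtype (Finset.univ.filter fun x : Equiv.Perm (Fin d) => x * x = σ)
    (by simp) (fun x => if f.color ∘ x = f.color then diagWeight a f else 0), ← Finset.sum_filter,
    Finset.filter_filter, Finset.sum_const, nsmul_eq_mul, mul_comm]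
  congr 3
  ext x
  simp [mem_squareRoots, Equiv.ext_iff]

theorem isGelfandModel_wreathModule_gelfandModule [NeZero ℓ] :
    IsGelfandModel (wreathModule (gelfandModule ℓ d)) := by
  have : Finite (GenSymm ℓ d) := Finite.of_injective
    (fun s => (s.left, s.right)) fun s t h => SemidirectProduct.ext (congrArg Prod.fst h)
      (congrArg Prod.snd h)
  have : Fintype (GenSymm ℓ d) := Fintype.ofFinite _
  refine FDRep.isGelfandModel_of_character (τ := diagInvHom ℓ d) (fun s => ?_)
    character_diagInvHom _ fun s => ?_
  · simp [diagInvHom_apply]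
  · obtain ⟨a, σ⟩ := s
    rw [wreathModule_character, card_twisted_square_roots]
    simp only [selfTrace_gelfandModule]

theorem isGelfandModel_gelfandModule [NeZero ℓ] : IsGelfandModel (gelfandModule ℓ d) :=
  IsGelfandModel.of_equivalence (wreathFunctor ℓ d) isGelfandModel_wreathModule_gelfandModule

end Characters

theorem corollary2p33 (ℓ d : ℕ) (hℓ : 0 < ℓ) :
    IsGelfandModel (gelfandModule ℓ d) ∧ IsGelfandModel (wreathModule (gelfandModule ℓ d)) := by
  have : NeZero ℓ := ⟨hℓ.ne'⟩
  exact ⟨isGelfandModel_gelfandModule, isGelfandModel_wreathModule_gelfandModule⟩
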